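/- Let $K\subset\mathbb{C}$ be an imaginary quadratic field with ring of integers $\mathcal{O}$. A 1-dimensional $K$-lattice is a pair $L=(\Lambda,\phi)$, where $\Lambda\subset\mathbb{C}$ is a finitely generated $\mathcal{O}$-submodule with $\Lambda\otimes_{\mathcal{O}}K\cong K$ and $\phi:K/\mathcal{O}\to K\Lambda/\Lambda$ is $\mathcal{O}$-linear. Two $K$-lattices $(\Lambda,\phi)$ and $(\Lambda',\phi')$ are commensurable if $K\Lambda=K\Lambda'$ and $\phi=\phi'$ modulo $\Lambda+\Lambda'$. Let $X$ be the (compact) space of $K$-lattices up to scaling by $\mathbb{C}^*$, and let $G_K$ be the locally compact étale groupoid, with unit space $X$, of pairs $(L,L')$ of commensurable $K$-lattices modulo the scaling $\lambda(L,L')=(\lambda L,\lambda L')$, $\lambda\in\mathbb{C}^*$. Let $\mathcal{A}_K=C^*(G_K)$ be the completion of the convolution algebra $C_c(G_K)$, with product $$(f_1*f_2)(L,L')=\sum_{L''}f_1(L,L'')f_2(L'',L')$$ (sum over the $K$-lattices $L''$ commensurable with $L$), in the norm $\|f\|=\sup_{y\in X}\|\pi_y(f)\|$, where $\pi_y$ is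 the representation by left convolution on $\ell^2$ of the set of elements of $G_K$ with source $y$. Elements of $\mathcal{A}_K$ are regarded as functions on $G_K$ through the matrix coefficients of the $\pi_y$; in particular $f(L,L)=\langle\delta_{(L,L)},\pi_y(f)\delta_{(L,L)}\rangle$ with $y$ the class of $L$. Let $\sigma_t$ be the time evolution on $\mathcal{A}_K$ given by $$\sigma_t(f)(L,L')=\left(\frac{\mathrm{covolume}(\Lambda')}{\mathrm{covolume}(\Lambda)}\right)^{it}f(L,L').$$ Let $\beta>0$ and let $\varphi$ be a KMS$_\beta$ state on $(\mathcal{A}_K,\sigma_t)$: a state such that for all $x,y\in\mathcal{A}_K$ there is a bounded holomorphic function $F$ on the strip $0<\mathrm{Im}\,z<\beta$, extending continuously to the closed strip, with $F(t)=\varphi(x\sigma_t(y))$ and $F(t+i\beta)=\varphi(\sigma_t(y)x)$ for all $t\in\mathbb{R}$. Then there exists a probability measure $\mu$ on the Borel sets of $X$ such that $$\varphi(f)=\int_X f(L,L)\,d\mu(L)\qquad\text{for all } f\in\mathcal{A}_K .$$ -/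

import Mathlib

open NumberField TensorProduct MeasureTheory

noncomputable section

namespace CMSystem

variable (K : Type*) [Field K] [Algebra K ℂ]

/-- A finitely generated `𝓞 K`-submodule `Λ` of `ℂ` with `Λ ⊗ K ≅ K`. -/
structure Lat where
  carrier : Submodule (𝓞 K) ℂ
  fg : carrier.FG
  rank_one : Nonempty (K ⊗[𝓞 K] carrier ≃ₗ[K] K)

/-- The `𝓞 K`-module `K / 𝓞 K`. -/
abbrev KModO : Type _ := K ⧸ LinearMap.range (Algebra.linearMap (𝓞 K) K)

variable {K}

@[ext]
theorem Lat.ext {Λ Λ' : Lat K} (h : Λ.carrier = Λ'.carrier) : Λ = Λ' := by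
  cases Λ; cases Λ'; cases h; rfl

/-- The `K`-subspace `K Λ` of `ℂ`. -/
def Lat.spanK (Λ : Lat K) : Submodule K ℂ := Submodule.span K (Λ.carrier : Set ℂ)

/-- `Hom(K / 𝓞 K, K Λ / Λ)`, where `K Λ / Λ` is regarded as a submodule of `ℂ / Λ`. -/
def Level (Λ : Lat K) : Type _ :=
  {φ : KModO K →ₗ[𝓞 K] (ℂ ⧸ Λ.carrier) // ∀ x, ∃ z ∈ Λ.spanK, φ x = Λ.carrier.mkQ z}

/-- The topology of pointwise convergence on `Hom(K / 𝓞 K, K Λ / Λ)`, with `K Λ / Λ` discrete. -/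
instance (Λ : Lat K) : TopologicalSpace (Level Λ) :=
  ⨅ x : KModO K, TopologicalSpace.induced (fun φ : Level Λ => φ.1 x) ⊥

variable (K) in
/-- A 1-dimensional `K`-lattice `(Λ, φ)`. -/
structure KLattice where
  lat : Lat K
  level : Level lat

/-- Multiplication by `c ∈ ℂˣ`, as an `𝓞 K`-linear automorphism of `ℂ`. -/
def mulEquiv (c : ℂˣ) : ℂ ≃ₗ[𝓞 K] ℂ where
  toFun z := c * z
  invFun z := (c⁻¹ : ℂˣ) * z
  map_add' := mul_add _
  map_smul' a z := by simp
  left_inv z := by simp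
  right_inv z := by simp

@[simp] theorem mulEquiv_apply (c : ℂˣ) (z : ℂ) : mulEquiv (K := K) c z = c * z := rfl

@[simp] theorem mulEquiv_symm_apply (c : ℂˣ) (z : ℂ) :
    (mulEquiv (K := K) c).symm z = (c⁻¹ : ℂˣ) * z := rfl

/-- The lattice `c Λ`. -/
def Lat.scale (c : ℂˣ) (Λ : Lat K) : Lat K where
  carrier := Λ.carrier.map (mulEquiv c).toLinearMap
  fg := Λ.fg.map _
  rank_one := Λ.rank_one.map fun e =>
    (LinearEquiv.baseChange (𝓞 K) K _ _ ((mulEquiv c).submoduleMap Λ.carrier)).symm.trans e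

theorem Lat.mem_scale {c : ℂˣ} {Λ : Lat K} {z : ℂ} (hz : z ∈ Λ.carrier) :
    (c : ℂ) * z ∈ (Λ.scale c).carrier := Submodule.mem_map_of_mem hz

theorem Lat.mul_mem_spanK_scale {c : ℂˣ} {Λ : Lat K} {z : ℂ} (hz : z ∈ Λ.spanK) :
    (c : ℂ) * z ∈ (Λ.scale c).spanK := by
  induction hz using Submodule.span_induction with
  | mem x h => exact Submodule.subset_span (Lat.mem_scale h)
  | zero => simp
  | add x y _ _ hx hy => rw [mul_add]; exact add_mem hx hy
  | smul a x _ hx => rw [mul_smul_comm]; exact Submodule.smul_mem _ _ hx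

/-- The map `c φ : K / 𝓞 K → K (c Λ) / c Λ`. -/
def Level.scale (c : ℂˣ) {Λ : Lat K} (φ : Level Λ) : Level (Λ.scale c) :=
  ⟨(Submodule.mapQ Λ.carrier (Λ.scale c).carrier (mulEquiv c).toLinearMap
      (fun _ hz => Submodule.mem_map_of_mem hz)).comp φ.1, fun x => by
    obtain ⟨z, hz, h⟩ := φ.2 x
    refine ⟨c * z, Lat.mul_mem_spanK_scale hz, ?_⟩
    rw [LinearMap.comp_apply, h]
    rfl⟩

namespace KLattice

/-- `(Λ, φ)` and `(Λ', φ')` are commensurable when `K Λ = K Λ'` and `φ = φ'` modulo `Λ + Λ'`. -/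
def Commensurable (L L' : KLattice K) : Prop :=
  L.lat.spanK = L'.lat.spanK ∧
    ∀ x : KModO K,
      Submodule.factor (le_sup_left : L.lat.carrier ≤ L.lat.carrier ⊔ L'.lat.carrier)
          (L.level.1 x) =
        Submodule.factor (le_sup_right : L'.lat.carrier ≤ L.lat.carrier ⊔ L'.lat.carrier)
          (L'.level.1 x)

/-- Two `K`-lattices are equal as soon as the underlying lattices agree and the values of the
two homomorphisms have a common representative at each point. -/
theorem ext_rep {L M : KLattice K} (h : L.lat = M.lat)
    (hφ : ∀ x, ∃ z, L.level.1 x = L.lat.carrier.mkQ z ∧ M.level.1 x = M.lat.carrier.mkQ z) :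
    L = M := by
  obtain ⟨Λ, φ⟩ := L
  obtain ⟨Λ', φ'⟩ := M
  obtain rfl : Λ = Λ' := h
  congr 1
  apply Subtype.ext
  apply LinearMap.ext
  intro x
  obtain ⟨z, h1, h2⟩ := hφ x
  exact h1.trans h2.symm

theorem exists_rep (L : KLattice K) (x : KModO K) :
    ∃ z, L.level.1 x = L.lat.carrier.mkQ z := by
  obtain ⟨z, -, h⟩ := L.level.2 x
  exact ⟨z, h⟩

/-- Scaling of `K`-lattices: `c (Λ, φ) = (c Λ, c φ)`. -/
instance : SMul ℂˣ (KLattice K) := ⟨fun c L => ⟨L.lat.scale c, L.level.scale c⟩⟩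

@[simp] theorem smul_lat (c : ℂˣ) (L : KLattice K) : (c • L).lat = L.lat.scale c := rfl

theorem smul_level_apply (c : ℂˣ) (L : KLattice K) {x : KModO K} {z : ℂ}
    (h : L.level.1 x = L.lat.carrier.mkQ z) :
    (c • L).level.1 x = (c • L).lat.carrier.mkQ (c * z) := by
  refine (congrArg (Submodule.mapQ L.lat.carrier (L.lat.scale c).carrier
    (mulEquiv c).toLinearMap (fun _ hz => Submodule.mem_map_of_mem hz)) h).trans ?_
  rfl

instance : MulAction ℂˣ (KLattice K) where
  one_smul L := by
    refine ext_rep ?_ fun x => ?_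
    · ext z
      simp [Lat.scale]
    · obtain ⟨z, hz⟩ := L.exists_rep x
      exact ⟨z, by simpa using smul_level_apply 1 L hz, hz⟩
  mul_smul c d L := by
    refine ext_rep ?_ fun x => ?_
    · ext z
      simp [Lat.scale, mul_assoc, mul_left_comm]
    · obtain ⟨z, hz⟩ := L.exists_rep x
      refine ⟨c * (d * z), ?_, smul_level_apply c (d • L) (smul_level_apply d L hz)⟩
      simpa [mul_assoc] using smul_level_apply (c * d) L hz

theorem Commensurable.refl (L : KLattice K) : Commensurable L L := ⟨rfl, fun _ => rfl⟩

/-- In terms of representatives: `φ = φ'` modulo `Λ + Λ'`. -/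
theorem commensurable_iff {L L' : KLattice K} :
    Commensurable L L' ↔ L.lat.spanK = L'.lat.spanK ∧ ∀ x z z', L.level.1 x = L.lat.carrier.mkQ z →
      L'.level.1 x = L'.lat.carrier.mkQ z' → z - z' ∈ L.lat.carrier ⊔ L'.lat.carrier := by
  refine and_congr_right fun _ => forall_congr' fun x => ⟨fun h z z' hz hz' => ?_, fun h => ?_⟩
  · rw [hz, hz'] at h
    exact (Submodule.Quotient.eq _).1 h
  · obtain ⟨z, hz⟩ := L.exists_rep x
    obtain ⟨z', hz'⟩ := L'.exists_rep x
    rw [hz, hz']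
    exact (Submodule.Quotient.eq _).2 (h z z' hz hz')

theorem spanK_scale_le (c : ℂˣ) {Λ Λ' : Lat K} (h : Λ.spanK ≤ Λ'.spanK) :
    (Λ.scale c).spanK ≤ (Λ'.scale c).spanK := by
  refine Submodule.span_le.2 ?_
  rintro _ ⟨z, hz, rfl⟩
  exact Lat.mul_mem_spanK_scale (h (Submodule.subset_span hz))

theorem Commensurable.smul {L L' : KLattice K} (h : Commensurable L L') (c : ℂˣ) :
    Commensurable (c • L) (c • L') := by
  refine ⟨le_antisymm (spanK_scale_le c h.1.le) (spanK_scale_le c h.1.ge), fun x => ?_⟩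
  obtain ⟨z, hz⟩ := L.exists_rep x
  obtain ⟨z', hz'⟩ := L'.exists_rep x
  rw [smul_level_apply c L hz, smul_level_apply c L' hz']
  refine (Submodule.Quotient.eq _).2 ?_
  have := (commensurable_iff.1 h).2 x z z' hz hz'
  obtain ⟨a, ha, b, hb, hab⟩ := Submodule.mem_sup.1 this
  change (c : ℂ) * z - c * z' ∈ _
  rw [← mul_sub, ← hab, mul_add]
  exact Submodule.add_mem_sup (Lat.mem_scale ha) (Lat.mem_scale hb)

end KLattice

/-! ### Covolumes -/

/-- The covolume of `Λ` in `ℂ`. -/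
def Lat.covolume (Λ : Lat K) : ℝ := ZLattice.covolume (Λ.carrier.restrictScalars ℤ)

section Covolume

variable [NumberField K]

theorem Lat.countable (Λ : Lat K) : Countable Λ.carrier := by
  have : Countable (𝓞 K) := by
    obtain ⟨n, f, hf⟩ := Module.Finite.exists_fin' ℚ K
    have : Countable K := hf.countable
    exact (RingOfIntegers.coe_injective (K := K)).countable
  have : Module.Finite (𝓞 K) Λ.carrier := Module.Finite.iff_fg.2 Λ.fg
  obtain ⟨n, f, hf⟩ := Module.Finite.exists_fin' (𝓞 K) Λ.carrier
  exact hf.countable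

theorem Lat.exists_generator (Λ : Lat K) : ∃ ξ ∈ Λ.carrier, ξ ≠ 0 ∧
    ∀ z ∈ Λ.carrier, ∃ k : K, z = algebraMap K ℂ k * ξ := by
  obtain ⟨e⟩ := Λ.rank_one
  have hne : ∃ ξ ∈ Λ.carrier, ξ ≠ 0 := by
    by_contra! h
    have hs : Subsingleton Λ.carrier := ⟨fun a b => Subtype.ext ((h a a.2).trans (h b b.2).symm)⟩
    have : Subsingleton (K ⊗[𝓞 K] Λ.carrier) := inferInstance
    exact one_ne_zero (e.symm.injective (Subsingleton.elim (e.symm (1 : K)) (e.symm 0)))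
  obtain ⟨ξ, hξ, h0⟩ := hne
  refine ⟨ξ, hξ, h0, fun z hz => ?_⟩
  let g : K ⊗[𝓞 K] Λ.carrier →ₗ[K] ℂ := LinearMap.liftBaseChange K Λ.carrier.subtype
  have hg : ∀ y : Λ.carrier, g (1 ⊗ₜ y) = y := fun y => by simp [g]
  have key : ∀ w : K ⊗[𝓞 K] Λ.carrier, g w = algebraMap K ℂ (e w) * g (e.symm 1) := fun w => by
    have : w = (e w) • e.symm 1 := by
      apply e.injective
      simp
    conv_lhs => rw [this]
    rw [map_smul, Algebra.smul_def]
  have h1 := key (1 ⊗ₜ ⟨ξ, hξ⟩)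
  have h2 := key (1 ⊗ₜ ⟨z, hz⟩)
  rw [hg] at h1 h2
  simp only at h1 h2
  set k1 := e (1 ⊗ₜ ⟨ξ, hξ⟩)
  set k2 := e (1 ⊗ₜ ⟨z, hz⟩)
  have hk1 : k1 ≠ 0 := by
    intro h
    rw [h] at h1
    simp [h0] at h1
  refine ⟨k2 / k1, ?_⟩
  have : algebraMap K ℂ k1 ≠ 0 := by simpa using hk1
  rw [h1, h2, map_div₀]
  field_simp

theorem Lat.exists_denominator (Λ : Lat K) : ∃ ξ ∈ Λ.carrier, ξ ≠ 0 ∧ ∃ d : 𝓞 K, d ≠ 0 ∧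
    ∀ z ∈ Λ.carrier, ∃ a : 𝓞 K, algebraMap (𝓞 K) ℂ d * z = algebraMap (𝓞 K) ℂ a * ξ := by
  obtain ⟨ξ, hξ, h0, hgen⟩ := Λ.exists_generator
  refine ⟨ξ, hξ, h0, ?_⟩
  obtain ⟨S, hS⟩ := Λ.fg
  choose! k hk using hgen
  obtain ⟨b, hb⟩ := IsLocalization.exist_integer_multiples (nonZeroDivisors (𝓞 K)) S k
  refine ⟨b, nonZeroDivisors.ne_zero b.2, fun z hz => ?_⟩
  rw [← hS] at hz
  induction hz using Submodule.span_induction with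
  | mem x hx =>
    obtain ⟨a, ha⟩ := hb x hx
    refine ⟨a, ?_⟩
    have hxm : x ∈ Λ.carrier := hS ▸ Submodule.subset_span hx
    have ha' := congrArg (algebraMap K ℂ) ha
    rw [Algebra.smul_def, map_mul, ← IsScalarTower.algebraMap_apply,
      ← IsScalarTower.algebraMap_apply] at ha'
    rw [ha', mul_assoc, ← hk x hxm]
  | zero => exact ⟨0, by simp⟩
  | add x y _ _ hx hy =>
    obtain ⟨a, ha⟩ := hx
    obtain ⟨a', ha'⟩ := hy
    exact ⟨a + a', by rw [mul_add, ha, ha', map_add, add_mul]⟩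
  | smul c x _ hx =>
    obtain ⟨a, ha⟩ := hx
    exact ⟨c * a, by rw [Algebra.smul_def, mul_left_comm, ha, map_mul, mul_assoc]⟩

theorem volume_mul_image (c : ℂ) (s : Set ℂ) :
    volume ((fun z : ℂ => c * z) '' s) = ENNReal.ofReal (‖c‖ ^ 2) * volume s := by
  have h := Measure.addHaar_image_linearMap (volume : Measure ℂ) (Algebra.lmul ℝ ℂ c) s
  rw [← Algebra.norm_apply, Algebra.norm_complex_apply, Complex.normSq_eq_norm_sq,
    abs_of_nonneg (sq_nonneg _)] at h
  exact h

theorem covolume_scale (c : ℂˣ) (Λ : Lat K) :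
    (Λ.scale c).covolume = ‖(c : ℂ)‖ ^ 2 * Λ.covolume := by
  have hcc : ∀ Λ : Lat K, Countable (Λ.carrier.restrictScalars ℤ) := fun Λ => Λ.countable
  have hm : ∀ S : Submodule ℤ ℂ, MeasurableConstVAdd S ℂ := fun S =>
    (inferInstance : MeasurableConstVAdd S.toAddSubgroup ℂ)
  have hv : ∀ S : Submodule ℤ ℂ, VAddInvariantMeasure S ℂ volume := fun S =>
    (inferInstance : VAddInvariantMeasure S.toAddSubgroup ℂ volume)
  have hnull : ∀ d : ℂˣ, Measure.QuasiMeasurePreserving (fun z : ℂ => (d : ℂ) * z) volume volume :=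
    fun d => by
      refine ⟨by fun_prop, Measure.AbsolutelyContinuous.mk fun s hs h0 => ?_⟩
      rw [Measure.map_apply (by fun_prop) hs]
      have : (fun z : ℂ => (d : ℂ) * z) ⁻¹' s = (fun z : ℂ => ((d⁻¹ : ℂˣ) : ℂ) * z) '' s := by
        ext z
        constructor
        · intro hz
          exact ⟨_, hz, by simp⟩
        · rintro ⟨w, hw, rfl⟩
          simpa using hw
      rw [this, volume_mul_image, h0, mul_zero]
  have key : ∀ (c : ℂˣ) (Λ : Lat K) (s : Set ℂ),
      IsAddFundamentalDomain (Λ.carrier.restrictScalars ℤ) s →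
      IsAddFundamentalDomain ((Λ.scale c).carrier.restrictScalars ℤ)
        ((fun z : ℂ => c * z) '' s) := by
    intro c Λ s hs
    refine hs.image_of_equiv (mulEquiv (K := K) c).toEquiv (hnull c⁻¹)
      ((mulEquiv c).submoduleMap Λ.carrier).symm.toEquiv ?_
    intro g w
    obtain ⟨y, rfl⟩ := ((mulEquiv c).submoduleMap Λ.carrier).surjective g
    have : ((mulEquiv c).submoduleMap Λ.carrier).symm.toEquiv
        (((mulEquiv c).submoduleMap Λ.carrier) y) = y := LinearEquiv.symm_apply_apply _ _
    change (c : ℂ) * ((((mulEquiv c).submoduleMap Λ.carrier).symm.toEquiv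
        (((mulEquiv c).submoduleMap Λ.carrier) y)).1 + w) = c * y.1 + c * w
    rw [this, mul_add]
  by_cases h : HasAddFundamentalDomain (Λ.carrier.restrictScalars ℤ) ℂ
  · obtain ⟨s, hs⟩ := h.ExistsIsAddFundamentalDomain
    have := hcc Λ
    have := hcc (Λ.scale c)
    rw [Lat.covolume, Lat.covolume, ZLattice.covolume, ZLattice.covolume,
      hs.covolume_eq_volume, (key c Λ s hs).covolume_eq_volume, volume_mul_image,
      ENNReal.toReal_mul, ENNReal.toReal_ofReal (sq_nonneg _)]
  · have h' : ¬ HasAddFundamentalDomain ((Λ.scale c).carrier.restrictScalars ℤ) ℂ := by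
      rintro ⟨s, hs⟩
      have h2 := key c⁻¹ _ s hs
      have h3 : ((Λ.scale c).scale c⁻¹) = Λ := by
        ext z
        simp [Lat.scale]
      rw [h3] at h2
      exact h ⟨_, h2⟩
    simp [Lat.covolume, ZLattice.covolume, addCovolume, h, h']

variable [Algebra.IsQuadraticExtension ℚ K] [IsTotallyComplex K]

theorem one_le_norm_of_ne_zero {a : 𝓞 K} (ha : a ≠ 0) : 1 ≤ ‖algebraMap (𝓞 K) ℂ a‖ := by
  have hcard : Fintype.card (InfinitePlace K) = 1 := by
    have h1 := IsTotallyComplex.finrank (K := K)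
    rw [Algebra.IsQuadraticExtension.finrank_eq_two ℚ K] at h1
    have h2 := InfinitePlace.card_eq_nrRealPlaces_add_nrComplexPlaces K
    rw [IsTotallyComplex.nrRealPlaces_eq_zero] at h2
    omega
  have hsub : Subsingleton (InfinitePlace K) := Fintype.card_le_one_iff_subsingleton.1 hcard.le
  let w := InfinitePlace.mk (algebraMap K ℂ)
  have hw : w (a : K) = ‖algebraMap (𝓞 K) ℂ a‖ := by
    rw [InfinitePlace.apply]
    rfl
  have hprod := InfinitePlace.prod_eq_abs_norm (a : K)
  have huniq : (Finset.univ : Finset (InfinitePlace K)) = {w} :=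
    Finset.eq_singleton_iff_unique_mem.2 ⟨Finset.mem_univ _, fun _ _ => Subsingleton.elim _ _⟩
  rw [huniq, Finset.prod_singleton, IsTotallyComplex.mult_eq, hw] at hprod
  have hnorm : (1 : ℝ) ≤ ((|Algebra.norm ℚ (a : K)| : ℚ) : ℝ) := by
    have : Algebra.norm ℤ a ≠ 0 := Algebra.norm_ne_zero_iff.2 ha
    have h1 : (1 : ℤ) ≤ |Algebra.norm ℤ a| := Int.one_le_abs this
    rw [← Algebra.coe_norm_int]
    exact_mod_cast h1
  nlinarith [norm_nonneg (algebraMap (𝓞 K) ℂ a)]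

/-- `Λ` is discrete in `ℂ`. -/
instance Lat.discreteTopology (Λ : Lat K) : DiscreteTopology (Λ.carrier.restrictScalars ℤ) := by
  obtain ⟨ξ, hξ, h0, d, hd, h⟩ := Λ.exists_denominator
  have hdn : 0 < ‖algebraMap (𝓞 K) ℂ d‖ := lt_of_lt_of_le one_pos (one_le_norm_of_ne_zero hd)
  refine DiscreteTopology.of_forall_le_norm (r := ‖ξ‖ / ‖algebraMap (𝓞 K) ℂ d‖)
    (div_pos (norm_pos_iff.2 h0) hdn) fun z hz => ?_
  obtain ⟨a, ha⟩ := h z z.2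
  have hz' : (z : ℂ) ≠ 0 := fun h => hz (Subtype.ext h)
  have ha0 : a ≠ 0 := by
    rintro rfl
    rw [map_zero, zero_mul, mul_eq_zero] at ha
    exact ha.elim (norm_pos_iff.1 hdn) hz'
  rw [div_le_iff₀ hdn, ← mul_comm, Submodule.coe_norm, ← norm_mul, ha, norm_mul]
  exact le_mul_of_one_le_left (norm_nonneg _) (one_le_norm_of_ne_zero ha0)

/-- `Λ` spans `ℂ` over `ℝ`. -/
instance Lat.isZLattice (Λ : Lat K) : IsZLattice ℝ (Λ.carrier.restrictScalars ℤ) := by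
  obtain ⟨ξ, hξ, h0, -⟩ := Λ.exists_denominator
  have hx : ∃ x : 𝓞 K, (algebraMap (𝓞 K) ℂ x).im ≠ 0 := by
    by_contra! hx
    refine IsTotallyComplex.complexEmbedding_not_isReal (algebraMap K ℂ) ?_
    ext k
    obtain ⟨a, b, hb, rfl⟩ := IsFractionRing.div_surjective (A := 𝓞 K) k
    have hreal : ∀ y : 𝓞 K, (starRingEnd ℂ) (algebraMap K ℂ (algebraMap (𝓞 K) K y)) =
        algebraMap K ℂ (algebraMap (𝓞 K) K y) := fun y => Complex.conj_eq_iff_im.2 (hx y)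
    rw [ComplexEmbedding.conjugate_coe_eq, map_div₀, map_div₀, hreal, hreal]
  obtain ⟨x, hx⟩ := hx
  refine ⟨(Submodule.eq_top_iff').2 fun z => ?_⟩
  set t := algebraMap (𝓞 K) ℂ x
  have key : z = ((z / ξ).re - (z / ξ).im / t.im * t.re : ℝ) • ξ +
      ((z / ξ).im / t.im : ℝ) • (x • ξ) := by
    have : z / ξ = ((z / ξ).re - (z / ξ).im / t.im * t.re : ℝ) + ((z / ξ).im / t.im : ℝ) * t := by
      apply Complex.ext <;> simp [hx]
    rw [Complex.real_smul, Complex.real_smul, Algebra.smul_def, ← mul_assoc, ← add_mul,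
      show algebraMap (𝓞 K) ℂ x = t from rfl, ← this, div_mul_cancel₀ _ h0]
  rw [key]
  exact add_mem (Submodule.smul_mem _ _ (Submodule.subset_span hξ))
    (Submodule.smul_mem _ _ (Submodule.subset_span (Λ.carrier.smul_mem x hξ)))

theorem Lat.covolume_pos (Λ : Lat K) : 0 < Λ.covolume := by
  exact ZLattice.covolume_pos _ _

end Covolume

/-! ### The groupoid of commensurability modulo scaling -/

/-- The topology on the set of `K`-lattices: it is the final topology for the maps
`ℂˣ × Hom(K / 𝓞 K, K Λ / Λ) → {K-lattices}`, `(c, φ) ↦ (c Λ, c φ)`, for all `Λ`. Up to scaling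
there are finitely many `Λ`, so this is the topology of `⊔_i (ℂˣ × Hom(K / 𝓞 K, K Λ_i / Λ_i)) / (𝓞 K)ˣ`,
a disjoint union over representatives, as for two-dimensional `ℚ`-lattices. -/
instance : TopologicalSpace (KLattice K) :=
  ⨆ Λ : Lat K, TopologicalSpace.coinduced
    (fun q : ℂˣ × Level Λ => q.1 • (⟨Λ, q.2⟩ : KLattice K)) inferInstance

variable (K) in
/-- The equivalence relation of commensurability on `K`-lattices (not up to scaling), as the set
of pairs `(L, L')` of commensurable `K`-lattices. -/
def CommPair : Type _ := {p : KLattice K × KLattice K // p.1.Commensurable p.2}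

/-- Scaling of commensurable pairs: `c (L, L') = (c L, c L')`. -/
instance : MulAction ℂˣ (CommPair K) where
  smul c p := ⟨(c • p.1.1, c • p.1.2), p.2.smul c⟩
  one_smul _ := Subtype.ext (Prod.ext (one_smul _ _) (one_smul _ _))
  mul_smul _ _ _ := Subtype.ext (Prod.ext (mul_smul _ _ _) (mul_smul _ _ _))

/-- The pairs `(φ, φ')` such that `(Λ, φ)` and `(Λ', φ')` are commensurable, with the topology of
pointwise convergence. -/
abbrev CommLevel (Λ Λ' : Lat K) : Type _ :=
  {p : Level Λ × Level Λ' // KLattice.Commensurable ⟨Λ, p.1⟩ ⟨Λ', p.2⟩}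

/-- The commensurable pair `(c (Λ, φ), c (Λ', φ'))`. -/
def CommPair.chart (Λ Λ' : Lat K) (q : ℂˣ × CommLevel Λ Λ') : CommPair K :=
  let p : CommPair K := ⟨(⟨Λ, q.2.1.1⟩, ⟨Λ', q.2.1.2⟩), q.2.2⟩
  q.1 • p

/-- The topology of the étale groupoid of commensurable pairs: it is the final topology for the
maps `(c, φ, φ') ↦ (c (Λ, φ), c (Λ', φ'))`, for all `Λ` and `Λ'` (so the pairs `(c Λ, c Λ')` with
`Λ` and `Λ'` fixed form an open and closed subset, on which both projections are local
homeomorphisms). -/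
instance : TopologicalSpace (CommPair K) :=
  ⨆ (Λ : Lat K) (Λ' : Lat K), TopologicalSpace.coinduced (CommPair.chart Λ Λ') inferInstance

variable (K) in
/-- The space `X` of `K`-lattices up to scaling, with the quotient topology. -/
def LatticeSpace : Type _ := Quotient (MulAction.orbitRel ℂˣ (KLattice K))

instance : TopologicalSpace (LatticeSpace K) :=
  inferInstanceAs (TopologicalSpace (Quotient (MulAction.orbitRel ℂˣ (KLattice K))))

/-- The Borel σ-algebra of `X`. -/
instance : MeasurableSpace (LatticeSpace K) := borel _

instance : BorelSpace (LatticeSpace K) := ⟨rfl⟩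

variable (K) in
/-- The groupoid `G_K` of commensurable pairs of `K`-lattices up to scaling, with the quotient
topology. -/
def CommGroupoid : Type _ := Quotient (MulAction.orbitRel ℂˣ (CommPair K))

instance : TopologicalSpace (CommGroupoid K) :=
  inferInstanceAs (TopologicalSpace (Quotient (MulAction.orbitRel ℂˣ (CommPair K))))

namespace CommGroupoid

/-- The class in `G_K` of a commensurable pair `(L, L')`, an arrow with range the class of `L` and
source the class of `L'`. -/
def mk (L L' : KLattice K) (h : L.Commensurable L') : CommGroupoid K :=
  Quotient.mk (MulAction.orbitRel ℂˣ (CommPair K)) ⟨(L, L'), h⟩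

/-- The unit `(L, L)` of `G_K` attached to the class of `L` in `X`. -/
def unit (x : LatticeSpace K) : CommGroupoid K :=
  Quotient.lift (fun L : KLattice K => mk L L (.refl L)) (by
    rintro L M ⟨c, rfl⟩
    exact Quotient.sound ⟨c, rfl⟩) x

section Ratio

variable [NumberField K]

/-- `|L / L'| = covolume Λ' / covolume Λ`. -/
def ratio (γ : CommGroupoid K) : ℝ :=
  Quotient.lift (fun p : CommPair K => p.1.2.lat.covolume / p.1.1.lat.covolume) (by
    rintro p q ⟨c, rfl⟩
    change (q.1.2.lat.scale c).covolume / (q.1.1.lat.scale c).covolume = _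
    rw [covolume_scale, covolume_scale, mul_div_mul_left]
    simp) γ

theorem ratio_mk (L L' : KLattice K) (h : L.Commensurable L') :
    ratio (mk L L' h) = L'.lat.covolume / L.lat.covolume := rfl

theorem continuous_ratio : Continuous (ratio : CommGroupoid K → ℝ) := by
  refine Continuous.quotient_lift ?_ _
  refine continuous_iSup_dom.2 fun Λ => continuous_iSup_dom.2 fun Λ' =>
    continuous_coinduced_dom.2 ?_
  refine (continuous_const (y := Λ'.covolume / Λ.covolume)).congr fun q => ?_
  rw [Function.comp_apply]
  change _ = (Λ'.scale q.1).covolume / (Λ.scale q.1).covolume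
  rw [covolume_scale, covolume_scale, mul_div_mul_left]
  simp

variable [Algebra.IsQuadraticExtension ℚ K] [IsTotallyComplex K]

theorem ratio_pos (γ : CommGroupoid K) : 0 < ratio γ := by
  induction γ using Quotient.inductionOn with
  | h p => exact div_pos (Lat.covolume_pos _) (Lat.covolume_pos _)

/-- `|L / L'| ^ (i t)`. -/
def phase (t : ℝ) (γ : CommGroupoid K) : ℂ := (ratio γ : ℂ) ^ (Complex.I * t)

theorem norm_phase (t : ℝ) (γ : CommGroupoid K) : ‖phase t γ‖ = 1 := by
  rw [phase, Complex.norm_cpow_eq_rpow_re_of_pos (ratio_pos γ)]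
  simp

theorem continuous_phase (t : ℝ) : Continuous (phase t : CommGroupoid K → ℂ) :=
  (Complex.continuous_ofReal.comp continuous_ratio).cpow continuous_const fun γ =>
    Complex.ofReal_mem_slitPlane.2 (ratio_pos γ)

theorem phase_mul (t : ℝ) (L M N : KLattice K) (h : L.Commensurable M) (h1 : L.Commensurable N)
    (h2 : N.Commensurable M) :
    phase t (mk L M h) = phase t (mk L N h1) * phase t (mk N M h2) := by
  rw [phase, phase, phase, ← Complex.mul_cpow_ofReal_nonneg (ratio_pos _).le (ratio_pos _).le,
    ← Complex.ofReal_mul, ratio_mk, ratio_mk, ratio_mk]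
  have := L.lat.covolume_pos.ne'
  have := N.lat.covolume_pos.ne'
  congr 2
  field_simp

end Ratio

end CommGroupoid

/-! ### The algebra and its time evolution -/

open CommGroupoid

variable (K) in
/-- The Hilbert space `ℓ²(G_K)`, which is the Hilbert sum over the units `y ∈ X` of the spaces
`ℓ²((G_K)_y)`, where `(G_K)_y` is the set of arrows with source `y`. -/
abbrev HilbertSpace : Type _ := lp (fun _ : CommGroupoid K => ℂ) 2

/-- The operator `T` on `⨁_y ℓ²((G_K)_y)` is the left convolution by `f`, that is the sum of the
representations `π_y(f)`: `(T ξ)(L, M) = ∑_N f(L, N) ξ(N, M)`, where `N` runs over the `K`-lattices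
commensurable with `L` and `M`. -/
def IsLeftConvolution (f : CommGroupoid K → ℂ) (T : HilbertSpace K →L[ℂ] HilbertSpace K) : Prop :=
  ∀ (ξ : HilbertSpace K) (L M : KLattice K) (h : L.Commensurable M),
    HasSum (fun N : {N : KLattice K // L.Commensurable N ∧ N.Commensurable M} =>
      f (mk L N.1 N.2.1) * ξ (mk N.1 M N.2.2)) (T ξ (mk L M h))

variable (K) in
/-- The C*-algebra `A_K = C*(G_K)`: the C*-algebra of operators on `⨁_y ℓ²((G_K)_y)` generated by
the left convolutions by continuous functions with compact support on `G_K` (such convolutions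
form a *-algebra, whose norm closure is `A_K`; the norm is `‖f‖ = sup_y ‖π_y(f)‖`). -/
def CMAlgebra : StarSubalgebra ℂ (HilbertSpace K →L[ℂ] HilbertSpace K) :=
  (StarAlgebra.adjoin ℂ {T | ∃ f : CommGroupoid K → ℂ, Continuous f ∧ HasCompactSupport f ∧
    IsLeftConvolution f T}).topologicalClosure

open Classical in
/-- The value `f(L, L)` of an element `f` of `A_K` at the unit attached to the class of `L` in `X`.
An element `f` of the completed algebra is a function on `G_K` through
`f(γ) = ⟨δ_γ, f δ_{s(γ)}⟩`. -/
def CMAlgebra.diag (f : CMAlgebra K) (x : LatticeSpace K) : ℂ :=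
  (f.1 (lp.single 2 (unit x) 1)) (unit x)

/-- The multiplication by a function of modulus one on `ℓ²(ι)`. -/
def diagUnitary {ι : Type*} (u : ι → ℂ) (hu : ∀ i, ‖u i‖ = 1) :
    lp (fun _ : ι => ℂ) 2 ≃ₗᵢ[ℂ] lp (fun _ : ι => ℂ) 2 where
  toFun ξ := ⟨fun i => u i * ξ i, by
    refine memℓp_gen ?_
    simpa [hu] using (lp.memℓp ξ).summable (by norm_num)⟩
  invFun ξ := ⟨fun i => (u i)⁻¹ * ξ i, by
    refine memℓp_gen ?_
    simpa [hu] using (lp.memℓp ξ).summable (by norm_num)⟩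
  map_add' ξ η := by ext i; exact mul_add _ _ _
  map_smul' c ξ := by ext i; exact mul_left_comm _ _ _
  left_inv ξ := by
    ext i
    exact inv_mul_cancel_left₀ (norm_ne_zero_iff.1 (by simp [hu])) _
  right_inv ξ := by
    ext i
    exact mul_inv_cancel_left₀ (norm_ne_zero_iff.1 (by simp [hu])) _
  norm_map' ξ := by
    rw [lp.norm_eq_tsum_rpow (by norm_num), lp.norm_eq_tsum_rpow (by norm_num)]
    congr 1
    refine tsum_congr fun i => ?_
    change ‖u i * ξ i‖ ^ _ = _
    rw [norm_mul, hu, one_mul]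

section TimeEvolution

variable [NumberField K] [Algebra.IsQuadraticExtension ℚ K] [IsTotallyComplex K]

variable (K) in
/-- The multiplication by `|L / L'| ^ (i t)` on `ℓ²(G_K)`. -/
def timeUnitary (t : ℝ) : HilbertSpace K ≃ₗᵢ[ℂ] HilbertSpace K :=
  diagUnitary (phase t) (norm_phase t)

/-- Conjugation by the multiplication by `|L / L'| ^ (i t)` maps the convolution by `f` to the
convolution by the function `|L / L'| ^ (i t) f(L, L')`. -/
theorem IsLeftConvolution.conj {f : CommGroupoid K → ℂ}
    {T : HilbertSpace K →L[ℂ] HilbertSpace K} (h : IsLeftConvolution f T) (t : ℝ) :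
    IsLeftConvolution (fun γ => phase t γ * f γ) ((timeUnitary K t).conjStarAlgEquiv T) := by
  intro ξ L M hLM
  refine ((h ((timeUnitary K t).symm ξ) L M hLM).mul_left (phase t (mk L M hLM))).congr_fun ?_
  rintro ⟨N, h1, h2⟩
  have h0 : phase t (mk N M h2) ≠ 0 := norm_ne_zero_iff.1 (by simp [norm_phase])
  change _ = phase t (mk L M hLM) * (f (mk L N h1) * ((phase t (mk N M h2))⁻¹ * ξ (mk N M h2)))
  rw [phase_mul t L M N hLM h1 h2]
  field_simp

theorem conj_mem (t : ℝ) (a : HilbertSpace K →L[ℂ] HilbertSpace K) (ha : a ∈ CMAlgebra K) :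
    (timeUnitary K t).conjStarAlgEquiv a ∈ CMAlgebra K := by
  let g : (HilbertSpace K →L[ℂ] HilbertSpace K) →⋆ₐ[ℂ] (HilbertSpace K →L[ℂ] HilbertSpace K) :=
    ((timeUnitary K t).conjStarAlgEquiv : _ ≃⋆ₐ[ℂ] _)
  have hg : Continuous g :=
    (timeUnitary K t).toContinuousLinearEquiv.conjContinuousAlgEquiv.continuous
  have hle : CMAlgebra K ≤ (CMAlgebra K).comap g := by
    refine StarSubalgebra.topologicalClosure_minimal (StarAlgebra.adjoin_le ?_)
      ((StarSubalgebra.isClosed_topologicalClosure _).preimage hg)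
    rintro T ⟨f, hf, hs, hT⟩
    exact StarSubalgebra.le_topologicalClosure _ (StarAlgebra.subset_adjoin ℂ _
      ⟨_, (continuous_phase t).mul hf, hs.mul_left, hT.conj t⟩)
  exact hle ha

/-- The time evolution `σ_t` of `A_K`, given by `σ_t(f)(L, L') = |L / L'| ^ (i t) f(L, L')`. -/
def timeEvolution (t : ℝ) (a : CMAlgebra K) : CMAlgebra K :=
  ⟨(timeUnitary K t).conjStarAlgEquiv a.1, conj_mem t a.1 a.2⟩

end TimeEvolution

/-! ### KMS states -/

section KMS

variable {A : Type*} [Ring A] [StarRing A] [Algebra ℂ A]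

open scoped ComplexOrder in
/-- A state: a positive linear functional `φ` with `φ 1 = 1`. -/
structure IsState (φ : A →ₗ[ℂ] ℂ) : Prop where
  nonneg : ∀ a : A, 0 ≤ φ (star a * a)
  map_one : φ 1 = 1

/-- A KMS state at inverse temperature `β` for `(A, σ)`. -/
structure IsKMSState (σ : ℝ → A → A) (β : ℝ) (φ : A →ₗ[ℂ] ℂ) : Prop extends IsState φ where
  kms : ∀ x y : A, ∃ F : ℂ → ℂ,
    DifferentiableOn ℂ F {z | 0 < z.im ∧ z.im < β} ∧
    (∃ C : ℝ, ∀ z : ℂ, 0 < z.im → z.im < β → ‖F z‖ ≤ C) ∧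
    ContinuousOn F {z | 0 ≤ z.im ∧ z.im ≤ β} ∧
    ∀ t : ℝ, F t = φ (x * σ t y) ∧ F (t + Complex.I * β) = φ (σ t y * x)

end KMS

end CMSystem

end

set_option linter.unusedSectionVars false

noncomputable section

namespace CMSystem

variable {K : Type*} [Field K] [Algebra K ℂ]

/-! ### Arithmetic of lattices and commensurability -/

/-! The measure comes from restricting `φ` to `C(X)`, which sits in `A_K` as the multiplication
operators `diagOp g`, and applying Riesz representation on the compact Hausdorff space `X`. What has
to be shown is that `φ` sees only the restriction of a function to the units: by density of the
convolution algebra and continuity of `φ`, it suffices that `φ` vanishes on the convolution by any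
continuous compactly supported `f` that is zero on units (`IsKMSState.apply_eq_zero`).

Functions on `X` are fixed by the time evolution, so `φ` commutes with them in the trace sense: `φ(g
a) = φ(a g)`. If every arrow in the support of `f` has range different from source, finitely many
clopen sets of `X` separate range from source on that support. Replacing `a` by `p a p + (1 - p) a
(1 - p)` for the corresponding projections `p` does not change `φ(a)` and eventually kills `f`
(`IsKMSState.apply_eq_zero_of_range_ne_source`).

The obstruction is isotropy. A nontrivial arrow from a class to itself exists only at lattices `(Λ,
0)`, and these lie, for every `n ≥ 1`, in the clopen set of classes divisible by `n`. That set has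
small mass: sending a lattice to its image over `n⁻¹ Λ` gives an operator `w` with `w w* = 1` and
`w* w = p_n`, the projection onto divisible classes. Scaling by `n` multiplies covolumes by `n²`, so
`σ_t(w) = n^(-2it) w`, and the KMS condition forces `φ(p_n) = n^(-2β)`
(`IsKMSState.apply_divisible`). The part of `a` away from divisible classes has `φ`-value zero by
the previous paragraph, and Cauchy–Schwarz bounds the rest by `n^(-β) φ(a* a)^(1/2)`, which tends to
zero because `β > 0`.

The topological input is that commensurability is rigid: over a fixed `Λ'` at most one lattice is
commensurable with `(Λ, φ)`, and its existence is a condition on a single value of `φ`. Hence the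
groupoid is a union of compact open pieces indexed by pairs of lattices, and supports, products and
continuity can be checked piece by piece. -/

theorem KModO.mk_surjective (x : KModO K) : ∃ k : K, Submodule.Quotient.mk k = x :=
  Submodule.Quotient.mk_surjective _ x

/-- Divisibility of `K / 𝓞 K` allows every argument to be written `d • y`, so that denominators in
the ambiguity of representatives can be cleared by multiplying values at `y` by `d`. -/
theorem KModO.exists_smul_eq {d : 𝓞 K} (hd : d ≠ 0) (x : KModO K) : ∃ y : KModO K, d • y = x := by
  obtain ⟨k, rfl⟩ := KModO.mk_surjective x
  refine ⟨Submodule.Quotient.mk (k / d), ?_⟩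
  rw [← Submodule.Quotient.mk_smul, Algebra.smul_def]
  congr 1
  have : (d : K) ≠ 0 := by simpa using hd
  exact mul_div_cancel₀ k this

theorem KModO.mk_integer (a : 𝓞 K) : (Submodule.Quotient.mk (a : K) : KModO K) = 0 :=
  (Submodule.Quotient.mk_eq_zero _).2 ⟨a, rfl⟩

theorem Lat.algebraMap_ne_zero {d : 𝓞 K} (hd : d ≠ 0) : algebraMap (𝓞 K) ℂ d ≠ 0 := by
  rw [IsScalarTower.algebraMap_apply (𝓞 K) K ℂ]
  simpa using hd

/-- Commensurable `K`-lattices with the same underlying lattice are equal. -/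
theorem KLattice.Commensurable.eq_of_lat_eq {L M : KLattice K} (h : L.Commensurable M)
    (hl : L.lat = M.lat) : L = M := by
  refine KLattice.ext_rep hl fun x => ?_
  obtain ⟨z, hz⟩ := L.exists_rep x
  obtain ⟨w, hw⟩ := M.exists_rep x
  have := (KLattice.commensurable_iff.1 h).2 x z w hz hw
  rw [hl, sup_idem] at this
  exact ⟨z, hz, hw.trans ((Submodule.Quotient.eq _).2 this).symm⟩

theorem KLattice.Commensurable.symm {L M : KLattice K} (h : L.Commensurable M) :
    M.Commensurable L := by
  rw [KLattice.commensurable_iff] at h ⊢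
  refine ⟨h.1.symm, fun x z z' hz hz' => ?_⟩
  rw [sup_comm, ← neg_sub]
  exact neg_mem (h.2 x z' z hz' hz)

theorem KLattice.rep_smul {L : KLattice K} {x : KModO K} {z : ℂ}
    (h : L.level.1 x = L.lat.carrier.mkQ z) (d : 𝓞 K) :
    L.level.1 (d • x) = L.lat.carrier.mkQ (d • z) := by
  rw [map_smul, h, map_smul]

theorem KLattice.rep_sub_mem {L : KLattice K} {x : KModO K} {z w : ℂ}
    (h : L.level.1 x = L.lat.carrier.mkQ z) (h' : L.level.1 x = L.lat.carrier.mkQ w) :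
    z - w ∈ L.lat.carrier :=
  (Submodule.Quotient.eq _).1 (h.symm.trans h')

/-- To check commensurability it is enough to find suitable representatives. -/
theorem KLattice.commensurable_of_rep {L M : KLattice K} (h : L.lat.spanK = M.lat.spanK)
    (hr : ∀ x, ∃ z w, L.level.1 x = L.lat.carrier.mkQ z ∧ M.level.1 x = M.lat.carrier.mkQ w ∧
      z - w ∈ L.lat.carrier ⊔ M.lat.carrier) : L.Commensurable M := by
  refine KLattice.commensurable_iff.2 ⟨h, fun x z' w' hz' hw' => ?_⟩
  obtain ⟨z, w, hz, hw, hzw⟩ := hr x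
  have h1 : z' - z ∈ L.lat.carrier ⊔ M.lat.carrier :=
    Submodule.mem_sup_left (KLattice.rep_sub_mem hz' hz)
  have h2 : w - w' ∈ L.lat.carrier ⊔ M.lat.carrier :=
    Submodule.mem_sup_right (KLattice.rep_sub_mem hw hw')
  have := add_mem (add_mem h1 hzw) h2
  rwa [show z' - z + (z - w) + (w - w') = z' - w' by ring] at this

section

variable [NumberField K]

theorem exists_smul_eq_smul (k : K) : ∃ d : 𝓞 K, d ≠ 0 ∧ ∃ a : 𝓞 K, (d : K) * k = a := by
  obtain ⟨a, b, hb, rfl⟩ := IsFractionRing.div_surjective (A := 𝓞 K) k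
  have hb0 : b ≠ 0 := nonZeroDivisors.ne_zero hb
  have : (algebraMap (𝓞 K) K b) ≠ 0 := by simpa using hb0
  exact ⟨b, hb0, a, mul_div_cancel₀ _ this⟩

theorem KModO.exists_smul_eq_zero (x : KModO K) : ∃ d : 𝓞 K, d ≠ 0 ∧ d • x = 0 := by
  obtain ⟨k, rfl⟩ := KModO.mk_surjective x
  obtain ⟨d, hd, a, ha⟩ := exists_smul_eq_smul k
  refine ⟨d, hd, ?_⟩
  rw [← Submodule.Quotient.mk_smul, Algebra.smul_def]
  exact (congrArg _ ha).trans (KModO.mk_integer a)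

theorem algebraMap_smul_eq (k : K) (d a : 𝓞 K) (h : (d : K) * k = a) (z : ℂ) :
    d • (algebraMap K ℂ k * z) = a • z := by
  rw [Algebra.smul_def, Algebra.smul_def, ← mul_assoc,
    IsScalarTower.algebraMap_apply (𝓞 K) K ℂ, IsScalarTower.algebraMap_apply (𝓞 K) K ℂ,
    ← map_mul]
  congr 2

theorem Lat.exists_smul_mem (Λ : Lat K) {z : ℂ} (hz : z ∈ Λ.spanK) :
    ∃ d : 𝓞 K, d ≠ 0 ∧ d • z ∈ Λ.carrier := by
  induction hz using Submodule.span_induction with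
  | mem x h => exact ⟨1, one_ne_zero, by simpa using h⟩
  | zero => exact ⟨1, one_ne_zero, by simp⟩
  | add x y _ _ hx hy =>
    obtain ⟨a, ha, hx⟩ := hx
    obtain ⟨b, hb, hy⟩ := hy
    refine ⟨a * b, mul_ne_zero ha hb, ?_⟩
    rw [smul_add]
    refine add_mem ?_ ?_
    · rw [mul_comm, mul_smul]; exact Submodule.smul_mem _ _ hx
    · rw [mul_smul]; exact Submodule.smul_mem _ _ hy
  | smul k x _ hx =>
    obtain ⟨a, ha, hx⟩ := hx
    obtain ⟨d, hd, b, hb⟩ := exists_smul_eq_smul k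
    refine ⟨a * d, mul_ne_zero ha hd, ?_⟩
    rw [mul_smul, Algebra.smul_def k, algebraMap_smul_eq k d b hb, smul_comm]
    exact Submodule.smul_mem _ _ hx

/-- Lattices with the same `K`-span have a common denominator. -/
theorem Lat.exists_conductor {Λ Λ' : Lat K} (h : Λ.spanK = Λ'.spanK) :
    ∃ d : 𝓞 K, d ≠ 0 ∧ ∀ z ∈ Λ.carrier, d • z ∈ Λ'.carrier := by
  obtain ⟨ξ, hξ, -, d, hd, hden⟩ := Λ.exists_denominator
  obtain ⟨e, he, heξ⟩ := Λ'.exists_smul_mem (h ▸ Submodule.subset_span hξ : ξ ∈ Λ'.spanK)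
  refine ⟨e * d, mul_ne_zero he hd, fun z hz => ?_⟩
  obtain ⟨a, ha⟩ := hden z hz
  rw [mul_smul, Algebra.smul_def d, ha, ← Algebra.smul_def, smul_comm]
  exact Submodule.smul_mem _ _ heξ

/-- Adding the two congruences only gives one modulo the sum of all three lattices. Evaluating at `d
• y`, with `d` carrying the middle lattice into the first, absorbs the unwanted summand. -/
theorem KLattice.Commensurable.trans {L M N : KLattice K} (h : L.Commensurable M)
    (h' : M.Commensurable N) : L.Commensurable N := by
  refine KLattice.commensurable_of_rep (h.1.trans h'.1) fun x => ?_
  obtain ⟨d, hd, hc⟩ := Lat.exists_conductor h.1.symm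
  obtain ⟨y, rfl⟩ := KModO.exists_smul_eq hd x
  obtain ⟨z, hz⟩ := L.exists_rep y
  obtain ⟨w, hw⟩ := M.exists_rep y
  obtain ⟨v, hv⟩ := N.exists_rep y
  refine ⟨_, _, KLattice.rep_smul hz d, KLattice.rep_smul hv d, ?_⟩
  obtain ⟨a, ha, b, hb, hab⟩ := Submodule.mem_sup.1
    ((KLattice.commensurable_iff.1 h).2 y z w hz hw)
  obtain ⟨b', hb', e, he, hbe⟩ := Submodule.mem_sup.1
    ((KLattice.commensurable_iff.1 h').2 y w v hw hv)
  have : d • z - d • v = (d • a + d • (b + b')) + d • e := by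
    rw [← smul_sub, ← smul_add, ← smul_add]
    congr 1
    linear_combination -hab - hbe
  rw [this]
  exact Submodule.add_mem_sup (add_mem (Submodule.smul_mem _ _ ha) (hc _ (add_mem hb hb')))
    (Submodule.smul_mem _ _ he)

theorem Lat.spanK_eq_of_mem (Λ : Lat K) {ξ : ℂ} (hξ : ξ ∈ Λ.spanK) (h0 : ξ ≠ 0) {z : ℂ}
    (hz : z ∈ Λ.spanK) : ∃ k : K, z = algebraMap K ℂ k * ξ := by
  obtain ⟨η, -, -, hgen⟩ := Λ.exists_generator
  have key : ∀ w ∈ Λ.spanK, ∃ k : K, w = algebraMap K ℂ k * η := fun w hw => by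
    have : Λ.spanK ≤ Submodule.span K {η} := Submodule.span_le.2 fun w hw => by
      obtain ⟨k, hk⟩ := hgen w hw
      exact Submodule.mem_span_singleton.2 ⟨k, by rw [Algebra.smul_def, hk]⟩
    obtain ⟨k, hk⟩ := Submodule.mem_span_singleton.1 (this hw)
    exact ⟨k, by rw [← hk, Algebra.smul_def]⟩
  obtain ⟨k, rfl⟩ := key ξ hξ
  obtain ⟨l, rfl⟩ := key z hz
  have hk : algebraMap K ℂ k ≠ 0 := left_ne_zero_of_mul h0
  refine ⟨l / k, ?_⟩
  rw [map_div₀]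
  field_simp

theorem Lat.mem_scale_iff {c : ℂˣ} {Λ : Lat K} {z : ℂ} :
    z ∈ (Λ.scale c).carrier ↔ (c⁻¹ : ℂˣ) * z ∈ Λ.carrier := by
  constructor
  · rintro ⟨w, hw, rfl⟩
    simpa using hw
  · intro h
    simpa using Lat.mem_scale (c := c) h

theorem Lat.scale_scale (c d : ℂˣ) (Λ : Lat K) : (Λ.scale d).scale c = Λ.scale (c * d) := by
  ext z
  simp [Lat.mem_scale_iff, mul_assoc, mul_left_comm]

theorem Lat.scale_one (Λ : Lat K) : Λ.scale 1 = Λ := by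
  ext z
  simp [Lat.mem_scale_iff]

theorem Lat.scale_injective (c : ℂˣ) {Λ Λ' : Lat K} (h : Λ.scale c = Λ'.scale c) : Λ = Λ' := by
  simpa [Lat.scale_scale, Lat.scale_one] using congrArg (Lat.scale c⁻¹) h

/-- Rank one puts `c` in `K`; stability of a nonzero finitely generated module under `c` makes it
integral, and `𝓞 K` is integrally closed. -/
theorem Lat.exists_integer_of_scale_eq {Λ : Lat K} {c : ℂˣ} (h : Λ.scale c = Λ) :
    ∃ u : 𝓞 K, algebraMap (𝓞 K) ℂ u = c := by
  obtain ⟨ξ, hξ, h0, hgen⟩ := Λ.exists_generator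
  have hmem : ∀ z ∈ Λ.carrier, (c : ℂ) * z ∈ Λ.carrier := fun z hz => by
    have := Lat.mem_scale (c := c) hz
    rwa [h] at this
  obtain ⟨k, hk⟩ := hgen _ (hmem ξ hξ)
  have hk : (c : ℂ) = algebraMap K ℂ k := mul_right_cancel₀ h0 hk
  have hint : IsIntegral (𝓞 K) (c : ℂ) := by
    refine isIntegral_of_smul_mem_submodule (M := ℂ) Λ.carrier ?_ Λ.fg _ fun z hz => hmem z hz
    exact Submodule.ne_bot_iff _ |>.2 ⟨ξ, hξ, h0⟩
  rw [hk, isIntegral_algebraMap_iff (algebraMap K ℂ).injective] at hint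
  obtain ⟨u, hu⟩ := IsIntegrallyClosed.isIntegral_iff.1 hint
  refine ⟨u, ?_⟩
  rw [hk, ← hu, ← IsScalarTower.algebraMap_apply]

/-- An element of `ℂˣ` that stabilizes a lattice is a unit of `𝓞 K` and stabilizes all of them. -/
theorem Lat.scale_eq_of_scale_eq {Λ : Lat K} {c : ℂˣ} (h : Λ.scale c = Λ) (Λ' : Lat K) :
    Λ'.scale c = Λ' := by
  have h' : Λ.scale c⁻¹ = Λ := by
    conv_lhs => rw [← h]
    rw [Lat.scale_scale, inv_mul_cancel, Lat.scale_one]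
  obtain ⟨u, hu⟩ := Lat.exists_integer_of_scale_eq h
  obtain ⟨v, hv⟩ := Lat.exists_integer_of_scale_eq h'
  ext z
  rw [Lat.mem_scale_iff]
  refine ⟨fun hz => ?_, fun hz => ?_⟩
  · have := Λ'.carrier.smul_mem u hz
    rwa [Algebra.smul_def, hu, Units.mul_inv_cancel_left] at this
  · have := Λ'.carrier.smul_mem v hz
    rwa [Algebra.smul_def, hv] at this

theorem Lat.scale_eq_scale {Λ : Lat K} {c d : ℂˣ} (h : Λ.scale c = Λ.scale d) (Λ' : Lat K) :
    Λ'.scale c = Λ'.scale d := by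
  apply Lat.scale_injective d⁻¹
  rw [Lat.scale_scale, Lat.scale_scale, inv_mul_cancel, Lat.scale_one]
  apply Lat.scale_eq_of_scale_eq (Λ := Λ)
  rw [← Lat.scale_scale, h, Lat.scale_scale, inv_mul_cancel, Lat.scale_one]

/-! ### Arrows as pairs modulo scaling, and isotropy -/

namespace CommGroupoid

theorem mk_eq_mk_iff {L M L' M' : KLattice K} {h : L.Commensurable M} {h' : L'.Commensurable M'} :
    mk L M h = mk L' M' h' ↔ ∃ c : ℂˣ, L = c • L' ∧ M = c • M' := by
  refine Quotient.eq''.trans ⟨?_, ?_⟩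
  · rintro ⟨c, hc⟩
    exact ⟨c, congrArg (fun p => p.1.1) hc.symm, congrArg (fun p => p.1.2) hc.symm⟩
  · rintro ⟨c, rfl, rfl⟩
    exact ⟨c, rfl⟩

theorem mk_smul (c : ℂˣ) {L M : KLattice K} (h : L.Commensurable M) :
    mk (c • L) (c • M) (h.smul c) = mk L M h :=
  mk_eq_mk_iff.2 ⟨c, rfl, rfl⟩

/-- The scalar relating the two pairs fixes the lattice of `M`, hence is a unit of `𝓞 K` and fixes
every lattice, so `L` and `L'` are commensurable over one lattice. Consequently a sum over lattices
`N` commensurable with `M` is a sum over distinct arrows, although arrows are only classes modulo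
scaling. -/
theorem mk_left_injective {L L' M : KLattice K} {h : L.Commensurable M} {h' : L'.Commensurable M}
    (heq : mk L M h = mk L' M h') : L = L' := by
  obtain ⟨c, hL, hM⟩ := mk_eq_mk_iff.1 heq
  refine (h.trans h'.symm).eq_of_lat_eq ?_
  have hc : M.lat.scale c = M.lat := congrArg KLattice.lat hM.symm
  rw [← Lat.scale_eq_of_scale_eq hc L'.lat, hL]
  rfl

theorem ind {p : CommGroupoid K → Prop} (h : ∀ L M hLM, p (mk L M hLM)) (γ : CommGroupoid K) :
    p γ :=
  Quotient.inductionOn γ fun q => h q.1.1 q.1.2 q.2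

end CommGroupoid

theorem Lat.spanK_scale (Λ : Lat K) {k : K} {c : ℂˣ} (h : algebraMap K ℂ k = c) :
    (Λ.scale c).spanK = Λ.spanK := by
  have key : ∀ (k : K) (c : ℂˣ) (Λ : Lat K), algebraMap K ℂ k = c →
      (Λ.scale c).spanK ≤ Λ.spanK := fun k c Λ h => by
    refine Submodule.span_le.2 ?_
    rintro _ ⟨z, hz, rfl⟩
    change (c : ℂ) * z ∈ Λ.spanK
    rw [← h, ← Algebra.smul_def]
    exact Submodule.smul_mem _ _ (Submodule.subset_span hz)
  refine le_antisymm (key k c Λ h) ?_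
  have := key k⁻¹ c⁻¹ (Λ.scale c) (by simp [h])
  rwa [Lat.scale_scale, inv_mul_cancel, Lat.scale_one] at this

/-- A nontrivial isotropy arrow only exists at a `K`-lattice `(Λ, 0)`. -/
theorem KLattice.level_eq_zero_of_commensurable_smul {L : KLattice K} {c : ℂˣ}
    (h : L.Commensurable (c • L)) (hc : c • L ≠ L) : L.level.1 = 0 := by
  obtain ⟨ξ, hξ, h0, -⟩ := L.lat.exists_generator
  have hcξ : (c : ℂ) * ξ ∈ L.lat.spanK := by
    rw [h.1]
    exact Submodule.subset_span (Lat.mem_scale hξ)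
  obtain ⟨k, hk⟩ := L.lat.spanK_eq_of_mem (Submodule.subset_span hξ) h0 hcξ
  have hk : (c : ℂ) = algebraMap K ℂ k := mul_right_cancel₀ h0 hk
  -- Write `c = a / b`. Since `c ≠ 1`, the integer `b - a` is nonzero, and it suffices to kill the
  -- values at `(b - a) • y`.
  obtain ⟨b, hb, a, hba⟩ := exists_smul_eq_smul k
  have hab : b - a ≠ 0 := by
    intro hab
    refine hc ?_
    have hbK : (b : K) ≠ 0 := by simpa using hb
    have h1 : k = 1 := by
      rw [← sub_eq_zero.1 hab] at hba
      exact mul_left_cancel₀ hbK (by rw [hba, mul_one])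
    have : c = 1 := Units.ext (by rw [hk, h1, map_one, Units.val_one])
    rw [this, one_smul]
  refine LinearMap.ext fun x => ?_
  obtain ⟨y, rfl⟩ := KModO.exists_smul_eq hab x
  obtain ⟨z, hz⟩ := L.exists_rep y
  have hmem := (KLattice.commensurable_iff.1 h).2 y z _ hz (KLattice.smul_level_apply c L hz)
  obtain ⟨p, hp, _, ⟨q, hq, rfl⟩, hpq⟩ := Submodule.mem_sup.1 hmem
  change p + (c : ℂ) * q = z - c * z at hpq
  rw [KLattice.rep_smul hz]
  refine (Submodule.Quotient.mk_eq_zero _).2 ?_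
  -- Commensurability reads `z - c z = p + c q` with `p, q ∈ Λ`; multiplying by `b` and using `b c =
  -- a` gives the identity, whose right side lies in `Λ`.
  have : (b - a) • z = b • p + a • q := by
    have h2 : ∀ w, b • ((c : ℂ) * w) = a • w := fun w => by
      rw [hk, algebraMap_smul_eq k b a hba]
    rw [sub_smul, ← h2 z, ← h2 q, ← smul_sub, ← hpq, smul_add]
  rw [this]
  exact add_mem (Submodule.smul_mem _ _ hp) (Submodule.smul_mem _ _ hq)

/-- The image of `(Λ, φ)` on a larger lattice with the same `K`-span. -/
theorem KLattice.exists_enlarge (L : KLattice K) {Λ : Lat K} (hle : L.lat.carrier ≤ Λ.carrier)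
    (h : L.lat.spanK = Λ.spanK) : ∃ M : KLattice K, M.lat = Λ ∧ L.Commensurable M := by
  have hrep : ∀ x z, L.level.1 x = L.lat.carrier.mkQ z →
      ((Submodule.factor hle).comp L.level.1) x = Λ.carrier.mkQ z := fun x z hz =>
    congrArg (Submodule.factor hle) hz
  refine ⟨⟨Λ, (Submodule.factor hle).comp L.level.1, fun x => ?_⟩, rfl,
    KLattice.commensurable_of_rep h fun x => ?_⟩
  · obtain ⟨z, hz, h'⟩ := L.level.2 x
    exact ⟨z, h ▸ hz, hrep x z h'⟩
  · obtain ⟨z, hz⟩ := L.exists_rep x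
    exact ⟨z, z, hz, hrep x z hz, by simp⟩

end

end CMSystem

namespace CMSystem

variable {K : Type*} [Field K] [Algebra K ℂ]

open Topology Filter

/-! ### The topology of the groupoid -/

theorem Level.isOpen_setOf {Λ : Lat K} (x : KModO K) (P : ℂ ⧸ Λ.carrier → Prop) :
    IsOpen {φ : Level Λ | P (φ.1 x)} := by
  have h : IsOpen[TopologicalSpace.induced (fun φ : Level Λ => φ.1 x) ⊥]
      {φ : Level Λ | P (φ.1 x)} := ⟨{v | P v}, trivial, rfl⟩
  exact (iInf_le (fun x : KModO K =>
    TopologicalSpace.induced (fun φ : Level Λ => φ.1 x) ⊥) x) _ h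

theorem Level.isClopen_setOf {Λ : Lat K} (x : KModO K) (P : ℂ ⧸ Λ.carrier → Prop) :
    IsClopen {φ : Level Λ | P (φ.1 x)} :=
  ⟨⟨Level.isOpen_setOf x fun v => ¬ P v⟩, Level.isOpen_setOf x P⟩

theorem Level.continuous_of_isOpen {Y : Type*} [TopologicalSpace Y] {Λ : Lat K} {g : Y → Level Λ}
    (h : ∀ x v, IsOpen {y | (g y).1 x = v}) : Continuous g := by
  refine continuous_iInf_rng.2 fun x => continuous_induced_rng.2 ?_
  refine continuous_def.2 fun s _ => ?_
  have : ((fun φ : Level Λ => φ.1 x) ∘ g) ⁻¹' s = ⋃ v ∈ s, {y | (g y).1 x = v} := by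
    ext y
    simp
  rw [this]
  exact isOpen_biUnion fun v _ => h x v

theorem Level.le_nhds {Λ : Lat K} {φ : Level Λ} {u : Filter (Level Λ)}
    (h : ∀ x, ∀ᶠ ψ in u, ψ.1 x = φ.1 x) : u ≤ 𝓝 φ := by
  rw [nhds_iInf]
  refine le_iInf fun x => ?_
  rw [@nhds_induced _ _ ⊥]
  rintro s ⟨t, ht, hts⟩
  have ht' : φ.1 x ∈ t := @mem_of_mem_nhds _ ⊥ _ _ ht
  filter_upwards [h x] with ψ hψ
  refine hts ?_
  change ψ.1 x ∈ t
  rwa [hψ]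

/-- Multiplication by `d`, as a map `ℂ / Λ → ℂ / Λ'` when `d Λ ⊆ Λ'`. -/
def mulMap {Λ Λ' : Lat K} {d : 𝓞 K} (h : ∀ z ∈ Λ.carrier, d • z ∈ Λ'.carrier) :
    (ℂ ⧸ Λ.carrier) →ₗ[𝓞 K] (ℂ ⧸ Λ'.carrier) :=
  Submodule.mapQ Λ.carrier Λ'.carrier (d • LinearMap.id) fun z hz =>
    Submodule.mem_comap.2 (by simpa using h z hz)

theorem mulMap_mkQ {Λ Λ' : Lat K} {d : 𝓞 K} (h : ∀ z ∈ Λ.carrier, d • z ∈ Λ'.carrier) (z : ℂ) :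
    mulMap h (Λ.carrier.mkQ z) = Λ'.carrier.mkQ (d • z) := rfl

/-- The integer `d` carries both `Λ` and `Λ'` into `Λ'`, so the ambiguity modulo `Λ + Λ'`
disappears. By divisibility `φ'` is thus determined by `φ`, each value depending on one value of
`φ`. -/
theorem KLattice.Commensurable.level_smul {Λ Λ' : Lat K} {φ : Level Λ} {φ' : Level Λ'}
    (hcomm : KLattice.Commensurable ⟨Λ, φ⟩ ⟨Λ', φ'⟩) {d : 𝓞 K}
    (h : ∀ z ∈ Λ.carrier, d • z ∈ Λ'.carrier) (y : KModO K) :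
    φ'.1 (d • y) = mulMap h (φ.1 y) := by
  obtain ⟨z, hz⟩ := KLattice.exists_rep ⟨Λ, φ⟩ y
  obtain ⟨w, hw⟩ := KLattice.exists_rep ⟨Λ', φ'⟩ y
  obtain ⟨a, ha, b, hb, hab⟩ := Submodule.mem_sup.1
    ((KLattice.commensurable_iff.1 hcomm).2 y z w hz hw)
  simp only at hz hw ha hb hab
  rw [map_smul, hw, hz, mulMap_mkQ, ← map_smul]
  refine (Submodule.Quotient.eq _).2 ?_
  have : d • w - d • z = -(d • a + d • b) := by
    rw [← smul_sub, ← smul_add, ← smul_neg, hab, neg_sub]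
  rw [this]
  exact neg_mem (add_mem (h a ha) (Submodule.smul_mem _ _ hb))

/-- The only candidate is `φ'(k) = d φ(k / d)`. It descends from `K` to `K / 𝓞 K` exactly when it
vanishes at `k = 1`, a condition on the single value `φ(1 / d)`, hence clopen. -/
theorem KLattice.exists_commensurable_iff {Λ Λ' : Lat K} (hs : Λ.spanK = Λ'.spanK) {d : 𝓞 K}
    (hd : d ≠ 0) (h : ∀ z ∈ Λ.carrier, d • z ∈ Λ'.carrier) (φ : Level Λ) :
    (∃ φ' : Level Λ', KLattice.Commensurable ⟨Λ, φ⟩ ⟨Λ', φ'⟩) ↔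
      mulMap h (φ.1 (Submodule.Quotient.mk ((d : K)⁻¹))) = 0 := by
  have hdK : (d : K) ≠ 0 := by simpa using hd
  constructor
  · rintro ⟨φ', hφ'⟩
    rw [← hφ'.level_smul h, ← Submodule.Quotient.mk_smul, Algebra.smul_def]
    have : (Submodule.Quotient.mk (algebraMap (𝓞 K) K d * (d : K)⁻¹) : KModO K) = 0 := by
      rw [show algebraMap (𝓞 K) K d * (d : K)⁻¹ = ((1 : 𝓞 K) : K) by
        rw [mul_inv_cancel₀ hdK]; rfl]
      exact KModO.mk_integer 1
    rw [this, map_zero]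
  · intro h0
    let g : K →ₗ[𝓞 K] (ℂ ⧸ Λ'.carrier) :=
      (mulMap h).comp (φ.1.comp ((Submodule.mkQ _).comp (LinearMap.mulLeft (𝓞 K) ((d : K)⁻¹))))
    have hg : LinearMap.range (Algebra.linearMap (𝓞 K) K) ≤ LinearMap.ker g := by
      rintro _ ⟨a, rfl⟩
      change mulMap h (φ.1 (Submodule.Quotient.mk ((d : K)⁻¹ * algebraMap (𝓞 K) K a))) = 0
      rw [mul_comm, ← Algebra.smul_def, Submodule.Quotient.mk_smul, map_smul, map_smul, h0,
        smul_zero]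
    have key : ∀ k : K, (Submodule.liftQ _ g hg) (Submodule.Quotient.mk k) =
        mulMap h (φ.1 (Submodule.Quotient.mk ((d : K)⁻¹ * k))) := fun k => rfl
    have hval : ∀ k : K, ∃ z ∈ Λ.spanK, φ.1 (Submodule.Quotient.mk k) = Λ.carrier.mkQ (d • z) ∧
        (Submodule.liftQ _ g hg) (Submodule.Quotient.mk k) = Λ'.carrier.mkQ (d • z) := fun k => by
      obtain ⟨z, hz, hφ⟩ := φ.2 (Submodule.Quotient.mk ((d : K)⁻¹ * k))
      refine ⟨z, hz, ?_, by rw [key, hφ, mulMap_mkQ]⟩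
      rw [map_smul, ← hφ, ← map_smul, ← Submodule.Quotient.mk_smul, Algebra.smul_def]
      congr 2
      exact (mul_inv_cancel_left₀ hdK k).symm
    have hsm : ∀ z ∈ Λ.spanK, d • z ∈ Λ.spanK := fun z hz => by
      have := Submodule.smul_mem Λ.spanK (d : K) hz
      rwa [Algebra.smul_def, ← IsScalarTower.algebraMap_apply (𝓞 K) K ℂ, ← Algebra.smul_def]
        at this
    refine ⟨⟨Submodule.liftQ _ g hg, fun x => ?_⟩, KLattice.commensurable_of_rep hs fun x => ?_⟩
    · obtain ⟨k, rfl⟩ := KModO.mk_surjective x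
      obtain ⟨z, hz, -, h2⟩ := hval k
      exact ⟨d • z, hs ▸ hsm z hz, h2⟩
    · obtain ⟨k, rfl⟩ := KModO.mk_surjective x
      obtain ⟨z, hz, h1, h2⟩ := hval k
      exact ⟨_, _, h1, h2, by simp⟩

/-- The continuity of functions on `X` is checked on the spaces `Hom(K / 𝓞 K, K Λ / Λ)`. -/
theorem LatticeSpace.isOpen_of_forall {U : Set (LatticeSpace K)}
    (h : ∀ Λ : Lat K, IsOpen {φ : Level Λ | (Quotient.mk _ ⟨Λ, φ⟩ : LatticeSpace K) ∈ U}) :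
    IsOpen U := by
  refine (isQuotientMap_quot_mk (r := MulAction.orbitRel ℂˣ (KLattice K))).isOpen_preimage.1 ?_
  refine isOpen_iSup_iff.2 fun Λ => isOpen_coinduced.2 ?_
  convert (h Λ).preimage (continuous_snd (X := ℂˣ)) using 1
  ext q
  have : (Quotient.mk _ (q.1 • (⟨Λ, q.2⟩ : KLattice K)) : LatticeSpace K) =
    Quotient.mk _ ⟨Λ, q.2⟩ := Quotient.sound ⟨q.1, rfl⟩
  change (Quotient.mk _ (q.1 • (⟨Λ, q.2⟩ : KLattice K)) : LatticeSpace K) ∈ U ↔ _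
  rw [this]
  rfl

/-- The class in `X` of a `K`-lattice. -/
def LatticeSpace.mk (L : KLattice K) : LatticeSpace K := Quotient.mk _ L

theorem LatticeSpace.ind {p : LatticeSpace K → Prop} (h : ∀ L, p (LatticeSpace.mk L))
    (x : LatticeSpace K) : p x := Quotient.inductionOn x h

theorem LatticeSpace.mk_eq_mk_iff {L M : KLattice K} :
    LatticeSpace.mk L = LatticeSpace.mk M ↔ ∃ c : ℂˣ, L = c • M := by
  refine Quotient.eq''.trans ⟨?_, ?_⟩
  · rintro ⟨c, hc⟩
    exact ⟨c, hc.symm⟩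
  · rintro ⟨c, rfl⟩
    exact ⟨c, rfl⟩

theorem LatticeSpace.continuous_mk (Λ : Lat K) :
    Continuous fun φ : Level Λ => LatticeSpace.mk ⟨Λ, φ⟩ := by
  have h : Continuous fun q : ℂˣ × Level Λ => q.1 • (⟨Λ, q.2⟩ : KLattice K) :=
    continuous_iff_coinduced_le.2 (le_iSup (fun Λ : Lat K => TopologicalSpace.coinduced
      (fun q : ℂˣ × Level Λ => q.1 • (⟨Λ, q.2⟩ : KLattice K)) inferInstance) Λ)
  have h2 : Continuous fun φ : Level Λ => LatticeSpace.mk ((1 : ℂˣ) • (⟨Λ, φ⟩ : KLattice K)) :=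
    (continuous_quot_mk (r := MulAction.orbitRel ℂˣ (KLattice K))).comp
      (h.comp (Continuous.prodMk continuous_const continuous_id))
  simpa only [one_smul] using h2

theorem LatticeSpace.continuous_of_forall {Y : Type*} [TopologicalSpace Y]
    {g : LatticeSpace K → Y}
    (h : ∀ Λ : Lat K, Continuous fun φ : Level Λ => g (LatticeSpace.mk ⟨Λ, φ⟩)) :
    Continuous g :=
  continuous_def.2 fun _ hs => LatticeSpace.isOpen_of_forall fun Λ => hs.preimage (h Λ)

theorem LatticeSpace.isClopen_of_forall {U : Set (LatticeSpace K)}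
    (h : ∀ Λ : Lat K, IsClopen {φ : Level Λ | LatticeSpace.mk ⟨Λ, φ⟩ ∈ U}) : IsClopen U :=
  ⟨⟨LatticeSpace.isOpen_of_forall fun Λ => (h Λ).1.isOpen_compl⟩,
    LatticeSpace.isOpen_of_forall fun Λ => (h Λ).2⟩

namespace CommGroupoid

theorem isOpen_of_forall {U : Set (CommGroupoid K)}
    (h : ∀ Λ Λ' : Lat K, IsOpen {q : CommLevel Λ Λ' | mk ⟨Λ, q.1.1⟩ ⟨Λ', q.1.2⟩ q.2 ∈ U}) :
    IsOpen U := by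
  refine (isQuotientMap_quot_mk (r := MulAction.orbitRel ℂˣ (CommPair K))).isOpen_preimage.1 ?_
  refine isOpen_iSup_iff.2 fun Λ => isOpen_iSup_iff.2 fun Λ' => isOpen_coinduced.2 ?_
  convert (h Λ Λ').preimage (continuous_snd (X := ℂˣ)) using 1
  ext q
  have : (Quotient.mk _ (CommPair.chart Λ Λ' q) : CommGroupoid K) =
    mk ⟨Λ, q.2.1.1⟩ ⟨Λ', q.2.1.2⟩ q.2.2 := Quotient.sound ⟨q.1, rfl⟩
  change (Quotient.mk _ (CommPair.chart Λ Λ' q) : CommGroupoid K) ∈ U ↔ _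
  rw [this]
  rfl

theorem continuous_mk (Λ Λ' : Lat K) :
    Continuous fun q : CommLevel Λ Λ' => mk ⟨Λ, q.1.1⟩ ⟨Λ', q.1.2⟩ q.2 := by
  have h : Continuous (CommPair.chart Λ Λ') :=
    continuous_iff_coinduced_le.2 ((le_iSup (fun Λ' : Lat K => TopologicalSpace.coinduced
      (CommPair.chart Λ Λ') inferInstance) Λ').trans
        (le_iSup (fun Λ : Lat K => ⨆ Λ' : Lat K, TopologicalSpace.coinduced
      (CommPair.chart Λ Λ') inferInstance) Λ))
  have h2 : Continuous fun q : CommLevel Λ Λ' =>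
      (Quotient.mk _ (CommPair.chart Λ Λ' (1, q)) : CommGroupoid K) :=
    (continuous_quot_mk (r := MulAction.orbitRel ℂˣ (CommPair K))).comp
      (h.comp (Continuous.prodMk continuous_const continuous_id))
  refine h2.congr fun q => ?_
  exact Quotient.sound ⟨1, rfl⟩

theorem continuous_of_forall {Y : Type*} [TopologicalSpace Y] {g : CommGroupoid K → Y}
    (h : ∀ Λ Λ' : Lat K,
      Continuous fun q : CommLevel Λ Λ' => g (mk ⟨Λ, q.1.1⟩ ⟨Λ', q.1.2⟩ q.2)) :
    Continuous g :=
  continuous_def.2 fun _ hs => isOpen_of_forall fun Λ Λ' => hs.preimage (h Λ Λ')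

/-- The range of an arrow. -/
def range (γ : CommGroupoid K) : LatticeSpace K :=
  Quotient.lift (fun p : CommPair K => LatticeSpace.mk p.1.1) (by
    rintro p q ⟨c, rfl⟩
    exact LatticeSpace.mk_eq_mk_iff.2 ⟨c, rfl⟩) γ

/-- The source of an arrow. -/
def source (γ : CommGroupoid K) : LatticeSpace K :=
  Quotient.lift (fun p : CommPair K => LatticeSpace.mk p.1.2) (by
    rintro p q ⟨c, rfl⟩
    exact LatticeSpace.mk_eq_mk_iff.2 ⟨c, rfl⟩) γ

/-- The inverse of an arrow. -/
def inv (γ : CommGroupoid K) : CommGroupoid K :=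
  Quotient.lift (fun p : CommPair K => mk p.1.2 p.1.1 p.2.symm) (by
    rintro p q ⟨c, rfl⟩
    exact Quotient.sound ⟨c, rfl⟩) γ

@[simp] theorem range_mk {L M : KLattice K} (h : L.Commensurable M) :
    range (mk L M h) = LatticeSpace.mk L := rfl

@[simp] theorem source_mk {L M : KLattice K} (h : L.Commensurable M) :
    source (mk L M h) = LatticeSpace.mk M := rfl

@[simp] theorem inv_mk {L M : KLattice K} (h : L.Commensurable M) :
    inv (mk L M h) = mk M L h.symm := rfl

@[simp] theorem unit_mk (L : KLattice K) : unit (LatticeSpace.mk L) = mk L L (.refl L) := rfl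

theorem inv_inv [NumberField K] (γ : CommGroupoid K) : inv (inv γ) = γ := by
  induction γ using ind with
  | h L M h => rfl

theorem continuous_range : Continuous (range : CommGroupoid K → LatticeSpace K) :=
  continuous_of_forall fun Λ _ => (LatticeSpace.continuous_mk Λ).comp
    (continuous_fst.comp continuous_subtype_val)

theorem continuous_source : Continuous (source : CommGroupoid K → LatticeSpace K) :=
  continuous_of_forall fun _ Λ' => (LatticeSpace.continuous_mk Λ').comp
    (continuous_snd.comp continuous_subtype_val)

theorem continuous_inv : Continuous (inv : CommGroupoid K → CommGroupoid K) :=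
  continuous_of_forall fun Λ Λ' => (continuous_mk Λ' Λ).comp
    (g := fun q : CommLevel Λ' Λ => mk ⟨Λ', q.1.1⟩ ⟨Λ, q.1.2⟩ q.2)
    (f := fun q : CommLevel Λ Λ' => (⟨(q.1.2, q.1.1), q.2.symm⟩ : CommLevel Λ' Λ))
    (Continuous.subtype_mk (by fun_prop) _)

theorem continuous_unit : Continuous (unit : LatticeSpace K → CommGroupoid K) :=
  LatticeSpace.continuous_of_forall fun Λ => (continuous_mk Λ Λ).comp
    (g := fun q : CommLevel Λ Λ => mk ⟨Λ, q.1.1⟩ ⟨Λ, q.1.2⟩ q.2)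
    (f := fun φ : Level Λ => (⟨(φ, φ), .refl _⟩ : CommLevel Λ Λ))
    (Continuous.subtype_mk (by fun_prop) _)

/-- The open and closed set of the arrows `(c Λ, c Λ')`. -/
def piece (Λ Λ' : Lat K) : Set (CommGroupoid K) :=
  {γ | ∃ q : CommLevel Λ Λ', mk ⟨Λ, q.1.1⟩ ⟨Λ', q.1.2⟩ q.2 = γ}

theorem mem_piece_iff [NumberField K] {Λ Λ' : Lat K} {L M : KLattice K} (h : L.Commensurable M) :
    mk L M h ∈ piece Λ Λ' ↔ ∃ c : ℂˣ, L.lat = Λ.scale c ∧ M.lat = Λ'.scale c := by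
  constructor
  · rintro ⟨q, hq⟩
    obtain ⟨c, rfl, rfl⟩ := mk_eq_mk_iff.1 hq.symm
    exact ⟨c, rfl, rfl⟩
  · rintro ⟨c, hL, hM⟩
    have hL' : (c⁻¹ • L).lat = Λ := by
      rw [KLattice.smul_lat, hL, Lat.scale_scale, inv_mul_cancel, Lat.scale_one]
    have hM' : (c⁻¹ • M).lat = Λ' := by
      rw [KLattice.smul_lat, hM, Lat.scale_scale, inv_mul_cancel, Lat.scale_one]
    rw [← mk_smul c⁻¹ h]
    subst hL' hM'
    exact ⟨⟨((c⁻¹ • L).level, (c⁻¹ • M).level), h.smul c⁻¹⟩, rfl⟩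

theorem isClopen_piece [NumberField K] (Λ Λ' : Lat K) : IsClopen (piece Λ Λ') := by
  refine ⟨⟨isOpen_of_forall fun Λ₁ Λ₂ => ?_⟩, isOpen_of_forall fun Λ₁ Λ₂ => ?_⟩
  · simp only [Set.mem_compl_iff, mem_piece_iff]
    exact isOpen_const
  · simp only [mem_piece_iff]
    exact isOpen_const

/-- Whether the arrow over `(Λ, Λ')` is a unit depends only on whether `Λ = Λ'`, not on the level
structures, so the condition is constant on each chart. -/
theorem isClopen_range_unit [NumberField K] :
    IsClopen (Set.range (unit : LatticeSpace K → CommGroupoid K)) := by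
  have h : ∀ Λ Λ' : Lat K, ∀ q : CommLevel Λ Λ', mk ⟨Λ, q.1.1⟩ ⟨Λ', q.1.2⟩ q.2 ∈
      Set.range (unit : LatticeSpace K → CommGroupoid K) ↔ Λ = Λ' := fun Λ Λ' q => by
    constructor
    · rintro ⟨x, hx⟩
      induction x using LatticeSpace.ind with
      | h L =>
        obtain ⟨c, h1, h2⟩ := mk_eq_mk_iff.1 (hx.symm.trans (unit_mk L))
        exact congrArg KLattice.lat (h1.trans h2.symm)
    · intro hΛ
      have h1 : (⟨Λ, q.1.1⟩ : KLattice K) = ⟨Λ', q.1.2⟩ := q.2.eq_of_lat_eq hΛ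
      refine ⟨LatticeSpace.mk ⟨Λ, q.1.1⟩, ?_⟩
      rw [unit_mk]
      congr 1
  refine ⟨⟨isOpen_of_forall fun Λ₁ Λ₂ => ?_⟩, isOpen_of_forall fun Λ₁ Λ₂ => ?_⟩
  · simp only [Set.mem_compl_iff, h]
    exact isOpen_const
  · simp only [h]
    exact isOpen_const

end CommGroupoid

/-! ### Extension of level structures and compactness -/

section

variable [NumberField K]

/-- The set of `φ` that extend to `K`-lattices over `Λ'`. -/
def extendable (Λ Λ' : Lat K) : Set (Level Λ) :=
  {φ | ∃ φ' : Level Λ', KLattice.Commensurable ⟨Λ, φ⟩ ⟨Λ', φ'⟩}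

theorem isClopen_extendable (Λ Λ' : Lat K) : IsClopen (extendable Λ Λ') := by
  by_cases hs : Λ.spanK = Λ'.spanK
  · obtain ⟨d, hd, h⟩ := Lat.exists_conductor hs
    have := Level.isClopen_setOf (Λ := Λ) (Submodule.Quotient.mk ((d : K)⁻¹))
      fun v => mulMap h v = 0
    simpa only [extendable, KLattice.exists_commensurable_iff hs hd h] using this
  · convert isClopen_empty
    ext φ
    simp only [extendable, Set.mem_ofPred_eq, Set.mem_empty_iff_false, iff_false]
    rintro ⟨φ', h⟩
    exact hs h.1

/-- The `K`-lattice over `Λ'` commensurable with `(Λ, φ)`. -/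
def extension {Λ Λ' : Lat K} (φ : extendable Λ Λ') : Level Λ' := φ.2.choose

theorem commensurable_extension {Λ Λ' : Lat K} (φ : extendable Λ Λ') :
    KLattice.Commensurable ⟨Λ, φ.1⟩ ⟨Λ', extension φ⟩ := φ.2.choose_spec

theorem continuous_extension {Λ Λ' : Lat K} :
    Continuous (extension : extendable Λ Λ' → Level Λ') := by
  refine Level.continuous_of_isOpen fun x v => ?_
  by_cases hs : Λ.spanK = Λ'.spanK
  · obtain ⟨d, hd, h⟩ := Lat.exists_conductor hs
    obtain ⟨y, rfl⟩ := KModO.exists_smul_eq hd x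
    have : {φ : extendable Λ Λ' | (extension φ).1 (d • y) = v} =
        Subtype.val ⁻¹' {φ : Level Λ | mulMap h (φ.1 y) = v} := by
      ext φ
      simp only [Set.mem_ofPred_eq, Set.mem_preimage, (commensurable_extension φ).level_smul h y]
    rw [this]
    exact (Level.isOpen_setOf y fun w => mulMap h w = v).preimage continuous_subtype_val
  · convert isOpen_empty
    ext φ
    exact ⟨fun _ => hs (commensurable_extension φ).1, fun h => h.elim⟩

/-- The `d`-torsion of `ℂ / Λ` is `d⁻¹ Λ / Λ`, a quotient of the finite module `Λ / d Λ`. -/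
theorem Lat.finite_torsion (Λ : Lat K) {d : 𝓞 K} (hd : d ≠ 0) :
    {v : ℂ ⧸ Λ.carrier | d • v = 0}.Finite := by
  have hdC : algebraMap (𝓞 K) ℂ d ≠ 0 := Lat.algebraMap_ne_zero hd
  have : Finite (𝓞 K ⧸ Ideal.span {d}) :=
    Ideal.finiteQuotientOfFreeOfNeBot _ (by simpa using hd)
  have hfg : Module.Finite (𝓞 K) Λ.carrier := Module.Finite.iff_fg.2 Λ.fg
  have hfin : Finite (Λ.carrier ⧸ Ideal.span {d} • (⊤ : Submodule (𝓞 K) Λ.carrier)) :=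
    Submodule.finite_quotient_smul _ hfg.fg_top
  let f : Λ.carrier →ₗ[𝓞 K] (ℂ ⧸ Λ.carrier) :=
    Λ.carrier.mkQ.comp ((LinearMap.mulLeft (𝓞 K) ((algebraMap (𝓞 K) ℂ d)⁻¹)).comp
      Λ.carrier.subtype)
  have hf : Ideal.span {d} • (⊤ : Submodule (𝓞 K) Λ.carrier) ≤ LinearMap.ker f := by
    refine Submodule.smul_le.2 fun r hr w _ => ?_
    obtain ⟨a, rfl⟩ := Ideal.mem_span_singleton'.1 hr
    refine (Submodule.Quotient.mk_eq_zero _).2 ?_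
    have : (algebraMap (𝓞 K) ℂ d)⁻¹ * ((a * d) • w.1) = a • w.1 := by
      rw [Algebra.smul_def, Algebra.smul_def, map_mul]
      field_simp
    change (algebraMap (𝓞 K) ℂ d)⁻¹ * ((a * d) • w.1) ∈ _
    rw [this]
    exact Submodule.smul_mem _ _ w.2
  refine (Set.finite_range (Submodule.liftQ _ f hf)).subset fun v hv => ?_
  obtain ⟨z, rfl⟩ := Submodule.Quotient.mk_surjective _ v
  have hz : d • z ∈ Λ.carrier :=
    (Submodule.Quotient.mk_eq_zero _).1 ((Submodule.Quotient.mk_smul _ d z).trans hv)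
  refine ⟨Submodule.Quotient.mk ⟨d • z, hz⟩, ?_⟩
  change Λ.carrier.mkQ ((algebraMap (𝓞 K) ℂ d)⁻¹ * (d • z)) = Λ.carrier.mkQ z
  rw [Algebra.smul_def, inv_mul_cancel_left₀ hdC]

instance (Λ : Lat K) : CompactSpace (Level Λ) := by
  refine ⟨isCompact_iff_ultrafilter_le_nhds.2 fun u _ => ?_⟩
  -- If `d` kills `x`, the values at `x` lie in the finite `d`-torsion, so an ultrafilter is
  -- eventually constant at each point. Linearity of the limit involves only finitely many points at
  -- a time.
  have h1 : ∀ x : KModO K, ∃ v, ∀ᶠ ψ : Level Λ in u, ψ.1 x = v := fun x => by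
    obtain ⟨d, hd, hx⟩ := KModO.exists_smul_eq_zero x
    have hfin := Λ.finite_torsion hd
    have : (⋃ v ∈ {v : ℂ ⧸ Λ.carrier | d • v = 0}, {ψ : Level Λ | ψ.1 x = v}) ∈ u := by
      refine Filter.mem_of_superset Filter.univ_mem fun ψ _ => ?_
      simp only [Set.mem_iUnion]
      exact ⟨ψ.1 x, by simp [← map_smul, hx], rfl⟩
    obtain ⟨v, -, hv⟩ := (Ultrafilter.finite_biUnion_mem_iff hfin).1 this
    exact ⟨v, hv⟩
  choose v hv using h1
  let φ : KModO K →ₗ[𝓞 K] (ℂ ⧸ Λ.carrier) :=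
    { toFun := v
      map_add' := fun x y => by
        obtain ⟨ψ, h1, h2, h3⟩ := ((hv x).and ((hv y).and (hv (x + y)))).exists
        rw [← h1, ← h2, ← h3, map_add]
      map_smul' := fun a x => by
        obtain ⟨ψ, h1, h2⟩ := ((hv x).and (hv (a • x))).exists
        rw [← h1, ← h2, map_smul, RingHom.id_apply] }
  refine ⟨⟨φ, fun x => ?_⟩, trivial, Level.le_nhds hv⟩
  obtain ⟨ψ, h1⟩ := (hv x).exists
  obtain ⟨z, hz, h2⟩ := ψ.2 x
  exact ⟨z, hz, h1.symm.trans h2⟩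

namespace CommGroupoid

/-- By uniqueness of the extension, an arrow over `(Λ, Λ')` is parametrized by `φ` alone, which
ranges over a clopen subset of the compact space `Level Λ`. -/
theorem isCompact_piece (Λ Λ' : Lat K) : IsCompact (piece Λ Λ') := by
  have hc : CompactSpace (extendable Λ Λ') :=
    isCompact_iff_compactSpace.1 (isClopen_extendable Λ Λ').1.isCompact
  have hcont : Continuous fun φ : extendable Λ Λ' =>
      mk ⟨Λ, φ.1⟩ ⟨Λ', extension φ⟩ (commensurable_extension φ) :=
    (continuous_mk Λ Λ').comp
    (g := fun q : CommLevel Λ Λ' => mk ⟨Λ, q.1.1⟩ ⟨Λ', q.1.2⟩ q.2)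
    (f := fun φ : extendable Λ Λ' =>
      (⟨(φ.1, extension φ), commensurable_extension φ⟩ : CommLevel Λ Λ'))
    (Continuous.subtype_mk (continuous_subtype_val.prodMk continuous_extension) _)
  convert isCompact_range hcont
  ext γ
  constructor
  · rintro ⟨⟨⟨φ, φ'⟩, h⟩, rfl⟩
    refine ⟨⟨φ, φ', h⟩, ?_⟩
    have := ((commensurable_extension ⟨φ, φ', h⟩).symm.trans h).eq_of_lat_eq rfl
    simp only at this
    simp only [this]
  · rintro ⟨φ, rfl⟩
    exact ⟨⟨(φ.1, extension φ), commensurable_extension φ⟩, rfl⟩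

/-- For each `Λ` a function with compact support on the groupoid involves only finitely many of the
lattices commensurable with `Λ`. -/
theorem exists_finite_of_hasCompactSupport {f : CommGroupoid K → ℂ} (hf : HasCompactSupport f)
    (Λ : Lat K) : ∃ S : Set (Lat K), S.Finite ∧
      ∀ L M h, L.lat = Λ → f (mk L M h) ≠ 0 → M.lat ∈ S := by
  obtain ⟨t, ht⟩ := hf.elim_finite_subcover (fun p : Lat K × Lat K => piece p.1 p.2)
    (fun p => (isClopen_piece p.1 p.2).2) fun γ _ => by
      induction γ using ind with
      | h L M h => exact Set.mem_iUnion.2 ⟨(L.lat, M.lat), ⟨(L.level, M.level), h⟩, rfl⟩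
  refine ⟨⋃ p ∈ t, {Λ' | ∃ c : ℂˣ, Λ = p.1.scale c ∧ Λ' = p.2.scale c}, ?_, ?_⟩
  · refine t.finite_toSet.biUnion fun p _ => Set.Subsingleton.finite ?_
    rintro _ ⟨c, h1, rfl⟩ _ ⟨c', h2, rfl⟩
    exact Lat.scale_eq_scale (h1.symm.trans h2) _
  · intro L M h hL hne
    have := ht (subset_tsupport f hne)
    simp only [Set.mem_iUnion] at this ⊢
    obtain ⟨p, hp, hpc⟩ := this
    obtain ⟨c, h1, h2⟩ := (mem_piece_iff h).1 hpc
    exact ⟨p, hp, c, hL ▸ h1, h2⟩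

end CommGroupoid

/-! ### Finiteness of lattices up to scaling, from the class group -/

open scoped nonZeroDivisors in
theorem Lat.exists_ideal (Λ : Lat K) : ∃ (I : (Ideal (𝓞 K))⁰) (η : ℂˣ),
    ∀ z, z ∈ Λ.carrier ↔ ∃ a ∈ I.1, z = algebraMap (𝓞 K) ℂ a * η := by
  obtain ⟨ξ, hξ, h0, d, hd, hden⟩ := Λ.exists_denominator
  have hdC : algebraMap (𝓞 K) ℂ d ≠ 0 := Lat.algebraMap_ne_zero hd
  have hη : ξ / algebraMap (𝓞 K) ℂ d ≠ 0 := div_ne_zero h0 hdC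
  refine ⟨⟨Λ.carrier.comap (LinearMap.toSpanSingleton (𝓞 K) ℂ (ξ / algebraMap (𝓞 K) ℂ d)),
    mem_nonZeroDivisors_iff_ne_zero.2 ?_⟩, Units.mk0 _ hη, fun z => ⟨fun hz => ?_, ?_⟩⟩
  · refine (Submodule.ne_bot_iff _).2 ⟨d, ?_, hd⟩
    rw [Submodule.mem_comap, LinearMap.toSpanSingleton_apply, Algebra.smul_def,
      mul_div_cancel₀ _ hdC]
    exact hξ
  · obtain ⟨a, ha⟩ := hden z hz
    have : z = algebraMap (𝓞 K) ℂ a * (ξ / algebraMap (𝓞 K) ℂ d) := by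
      rw [← mul_div_assoc, ← ha, mul_div_cancel_left₀ _ hdC]
    refine ⟨a, ?_, this⟩
    rw [Submodule.mem_comap, LinearMap.toSpanSingleton_apply, Algebra.smul_def, ← this]
    exact hz
  · rintro ⟨a, ha, rfl⟩
    rw [Submodule.mem_comap, LinearMap.toSpanSingleton_apply, Algebra.smul_def] at ha
    exact ha

open scoped nonZeroDivisors in
theorem Lat.eq_scale_of_ideal_class {Λ Λ' : Lat K} {I I' : (Ideal (𝓞 K))⁰} {η η' : ℂˣ}
    (h : ∀ z, z ∈ Λ.carrier ↔ ∃ a ∈ I.1, z = algebraMap (𝓞 K) ℂ a * η)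
    (h' : ∀ z, z ∈ Λ'.carrier ↔ ∃ a ∈ I'.1, z = algebraMap (𝓞 K) ℂ a * η')
    (hI : ClassGroup.mk0 I = ClassGroup.mk0 I') : ∃ c : ℂˣ, Λ = Λ'.scale c := by
  obtain ⟨x, y, hx, hy, hxy⟩ := ClassGroup.mk0_eq_mk0_iff.1 hI
  have hxC : algebraMap (𝓞 K) ℂ x ≠ 0 := Lat.algebraMap_ne_zero hx
  have hyC : algebraMap (𝓞 K) ℂ y ≠ 0 := Lat.algebraMap_ne_zero hy
  have h0 := η.ne_zero
  have h0' := η'.ne_zero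
  refine ⟨Units.mk0 _ hyC * η / (Units.mk0 _ hxC * η'), ?_⟩
  ext z
  rw [Lat.mem_scale_iff, h, h']
  simp only [inv_div, Units.val_div_eq_div_val, Units.val_mul, Units.val_mk0]
  constructor
  · rintro ⟨a, ha, rfl⟩
    obtain ⟨b, hb, hab⟩ := Ideal.mem_span_singleton_mul.1
      (hxy ▸ Ideal.mem_span_singleton_mul.2 ⟨a, ha, rfl⟩ : x * a ∈ Ideal.span {y} * I'.1)
    refine ⟨b, hb, ?_⟩
    have := congrArg (algebraMap (𝓞 K) ℂ) hab
    rw [map_mul, map_mul] at this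
    field_simp
    exact this.symm
  · rintro ⟨b, hb, hz⟩
    obtain ⟨a, ha, hab⟩ := Ideal.mem_span_singleton_mul.1
      (hxy ▸ Ideal.mem_span_singleton_mul.2 ⟨b, hb, rfl⟩ : y * b ∈ Ideal.span {x} * I.1)
    refine ⟨a, ha, ?_⟩
    have := congrArg (algebraMap (𝓞 K) ℂ) hab
    rw [map_mul, map_mul] at this
    field_simp at hz
    have h2 : (algebraMap (𝓞 K) ℂ x) * z = algebraMap (𝓞 K) ℂ x * (algebraMap (𝓞 K) ℂ a * η) := by
      linear_combination hz - η * this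
    exact mul_left_cancel₀ hxC h2

variable (K) in
/-- Finitely many lattices represent all of them up to scaling. -/
theorem Lat.exists_finite_representatives : ∃ S : Set (Lat K), S.Finite ∧
    ∀ Λ : Lat K, ∃ Λ' ∈ S, ∃ c : ℂˣ, Λ = Λ'.scale c := by
  choose I η h using Lat.exists_ideal (K := K)
  let cl : Lat K → ClassGroup (𝓞 K) := fun Λ => ClassGroup.mk0 (I Λ)
  refine ⟨Set.range fun C : Set.range cl => C.2.choose, Set.finite_range _, fun Λ => ?_⟩
  have hC : cl Λ ∈ Set.range cl := ⟨Λ, rfl⟩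
  exact ⟨hC.choose, ⟨⟨_, hC⟩, rfl⟩,
    Lat.eq_scale_of_ideal_class (h _) (h _) hC.choose_spec.symm⟩

namespace CommGroupoid

/-- Up to scaling the first lattice ranges over a finite set of representatives, and each allows
finitely many second lattices, so finitely many compact pieces cover the support. -/
theorem hasCompactSupport_of_exists_finite {f : CommGroupoid K → ℂ}
    (h : ∀ Λ : Lat K, ∃ S : Set (Lat K), S.Finite ∧
      ∀ L M h, L.lat = Λ → f (mk L M h) ≠ 0 → M.lat ∈ S) : HasCompactSupport f := by
  obtain ⟨R, hR, hrep⟩ := Lat.exists_finite_representatives K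
  choose S hS hfS using h
  have hfin : (⋃ Λ ∈ R, (fun Λ' => (Λ, Λ')) '' S Λ).Finite :=
    hR.biUnion fun Λ _ => (hS Λ).image _
  refine HasCompactSupport.intro' (K := ⋃ p ∈ ⋃ Λ ∈ R, (fun Λ' => (Λ, Λ')) '' S Λ, piece p.1 p.2)
    (hfin.isCompact_biUnion fun p _ => isCompact_piece p.1 p.2)
    (hfin.isClosed_biUnion fun p _ => (isClopen_piece p.1 p.2).1) fun γ hγ => ?_
  by_contra hne
  refine hγ ?_
  induction γ using ind with
  | h L M hLM =>
    obtain ⟨Λ, hΛ, c, hc⟩ := hrep L.lat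
    have hL : (c⁻¹ • L).lat = Λ := by
      rw [KLattice.smul_lat, hc, Lat.scale_scale, inv_mul_cancel, Lat.scale_one]
    rw [← mk_smul c⁻¹ hLM] at hne ⊢
    refine Set.mem_biUnion (x := (Λ, (c⁻¹ • M).lat)) (Set.mem_biUnion hΛ
      ⟨_, hfS Λ _ _ _ hL hne, rfl⟩) ((mem_piece_iff _).2 ⟨1, ?_, ?_⟩)
    · rw [hL, Lat.scale_one]
    · rw [Lat.scale_one]

end CommGroupoid

instance : CompactSpace (LatticeSpace K) := by
  obtain ⟨R, hR, hrep⟩ := Lat.exists_finite_representatives K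
  refine ⟨?_⟩
  have : IsCompact (⋃ Λ ∈ R, Set.range fun φ : Level Λ => LatticeSpace.mk ⟨Λ, φ⟩) :=
    hR.isCompact_biUnion fun Λ _ => isCompact_range (LatticeSpace.continuous_mk Λ)
  convert this
  refine (Set.eq_univ_of_forall fun x => ?_).symm
  induction x using LatticeSpace.ind with
  | h L =>
    obtain ⟨Λ, hΛ, c, hc⟩ := hrep L.lat
    have hL : (c⁻¹ • L).lat = Λ := by
      rw [KLattice.smul_lat, hc, Lat.scale_scale, inv_mul_cancel, Lat.scale_one]
    refine Set.mem_biUnion hΛ ?_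
    subst hL
    exact ⟨(c⁻¹ • L).level, LatticeSpace.mk_eq_mk_iff.2 ⟨c⁻¹, rfl⟩⟩

end

end CMSystem

namespace CMSystem

variable {K : Type*} [Field K] [Algebra K ℂ] [NumberField K]

/-! ### Separation -/

theorem KModO.exists_smul_eq_zero_of_finite {s : Set (KModO K)} (hs : s.Finite) :
    ∃ d : 𝓞 K, d ≠ 0 ∧ ∀ x ∈ s, d • x = 0 := by
  choose d hd h using KModO.exists_smul_eq_zero (K := K)
  refine ⟨∏ x ∈ hs.toFinset, d x, Finset.prod_ne_zero_iff.2 fun x _ => hd x, fun x hx => ?_⟩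
  obtain ⟨a, ha⟩ := Finset.dvd_prod_of_mem d (hs.mem_toFinset.2 hx)
  rw [ha, mul_comm, mul_smul, h, smul_zero]

theorem KModO.eq_smul_inv {d : 𝓞 K} (hd : d ≠ 0) {x : KModO K} (hx : d • x = 0) :
    ∃ a : 𝓞 K, x = a • Submodule.Quotient.mk ((d : K)⁻¹) := by
  obtain ⟨k, rfl⟩ := KModO.mk_surjective x
  rw [← Submodule.Quotient.mk_smul, Submodule.Quotient.mk_eq_zero] at hx
  obtain ⟨a, ha⟩ := hx
  refine ⟨a, ?_⟩
  have hdK : (d : K) ≠ 0 := by simpa using hd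
  rw [← Submodule.Quotient.mk_smul, Algebra.smul_def]
  congr 1
  rw [Algebra.smul_def] at ha
  change (a : K) = d * k at ha
  change k = (a : K) * (d : K)⁻¹
  rw [ha, mul_comm, inv_mul_cancel_left₀ hdK]

section

variable [Algebra.IsQuadraticExtension ℚ K] [IsTotallyComplex K]

/-- Covolumes fix `|c|`, so for a nonzero `ξ ∈ Λ` the points `c ξ` lie in a bounded part of the
discrete closed set `Λ'`. -/
theorem Lat.finite_setOf_eq_scale (Λ Λ' : Lat K) : {c : ℂˣ | Λ' = Λ.scale c}.Finite := by
  obtain ⟨ξ, hξ, h0, -⟩ := Λ.exists_generator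
  have hdisc : DiscreteTopology (Λ'.carrier.restrictScalars ℤ).toAddSubgroup :=
    Λ'.discreteTopology
  have hclosed : IsClosed ((Λ'.carrier.restrictScalars ℤ).toAddSubgroup : Set ℂ) :=
    AddSubgroup.isClosed_of_discrete
  have hfin := Metric.finite_isBounded_inter_isClosed (K := Metric.closedBall (0 : ℂ)
    (√(Λ'.covolume / Λ.covolume) * ‖ξ‖)) hdisc.isDiscrete Metric.isBounded_closedBall hclosed
  refine Set.Finite.of_finite_image (f := fun c : ℂˣ => (c : ℂ) * ξ) (hfin.subset ?_) ?_
  · rintro _ ⟨c, hc, rfl⟩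
    have hc : Λ' = Λ.scale c := hc
    refine ⟨?_, ?_⟩
    · rw [mem_closedBall_zero_iff, norm_mul]
      refine mul_le_mul_of_nonneg_right ?_ (norm_nonneg _)
      rw [hc, covolume_scale, mul_div_cancel_right₀ _ Λ.covolume_pos.ne',
        Real.sqrt_sq (norm_nonneg _)]
    · change (c : ℂ) * ξ ∈ Λ'.carrier
      rw [hc]
      exact Lat.mem_scale hξ
  · intro c _ c' _ h
    exact Units.ext (mul_right_cancel₀ h0 h)

/-- Distinct points of `X` are separated by open and closed sets. -/
theorem LatticeSpace.exists_isClopen {x y : LatticeSpace K} (hxy : x ≠ y) :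
    ∃ U : Set (LatticeSpace K), IsClopen U ∧ x ∈ U ∧ y ∉ U := by
  induction x using LatticeSpace.ind with
  | h L₀ =>
  -- For each `k`, the test asks for some scalar matching the lattices and the values at that one
  -- `k`; the scalar may depend on `k`. Each test is clopen and invariant under scaling, and passes
  -- at `L₀`.
  let A : KModO K → KLattice K → Prop := fun k L => ∃ c : ℂˣ, L₀.lat = L.lat.scale c ∧
    ∃ w, L.level.1 k = L.lat.carrier.mkQ w ∧ L₀.level.1 k = L₀.lat.carrier.mkQ (c * w)
  let U : KModO K → Set (LatticeSpace K) := fun k => {x | ∃ L, LatticeSpace.mk L = x ∧ A k L}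
  have hU : ∀ k L, LatticeSpace.mk L ∈ U k ↔ A k L := by
    refine fun k L => ⟨?_, fun h => ⟨L, rfl, h⟩⟩
    rintro ⟨M, hM, c, hc, w, h1, h2⟩
    obtain ⟨d, rfl⟩ := LatticeSpace.mk_eq_mk_iff.1 hM.symm
    refine ⟨c * d⁻¹, ?_, d * w, KLattice.smul_level_apply d M h1, ?_⟩
    · rw [KLattice.smul_lat, Lat.scale_scale, inv_mul_cancel_right, hc]
    · rw [h2]
      congr 1
      simp [mul_assoc]
  have hclopen : ∀ k, IsClopen (U k) := fun k => LatticeSpace.isClopen_of_forall fun Λ => by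
    simp only [hU]
    exact Level.isClopen_setOf k fun v => ∃ c : ℂˣ, L₀.lat = Λ.scale c ∧
      ∃ w, v = Λ.carrier.mkQ w ∧ L₀.level.1 k = L₀.lat.carrier.mkQ (c * w)
  have hmem : ∀ k, LatticeSpace.mk L₀ ∈ U k := fun k => (hU k L₀).2 (by
    obtain ⟨z, hz⟩ := L₀.exists_rep k
    exact ⟨1, (Lat.scale_one _).symm, z, hz, by simpa using hz⟩)
  by_contra! hcon
  have hy : ∀ k, y ∈ U k := fun k => hcon (U k) (hclopen k) (hmem k)
  induction y using LatticeSpace.ind with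
  | h L =>
  simp only [hU] at hy
  let B : ℂˣ → KModO K → Prop := fun c k =>
    ∃ w, L.level.1 k = L.lat.carrier.mkQ w ∧ L₀.level.1 k = L₀.lat.carrier.mkQ (c * w)
  -- Exchange of quantifiers. Only finitely many `c` match the lattices; if each failed at some `k
  -- c`, take `d` killing all these points. The scalar that works at `1 / d` then works at all
  -- multiples of it, in particular at its own `k c`.
  have hB : ∃ c : ℂˣ, L₀.lat = L.lat.scale c ∧ ∀ k, B c k := by
    by_contra! hB
    choose! k hk using hB
    obtain ⟨d, hd, h0⟩ := KModO.exists_smul_eq_zero_of_finite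
      ((Lat.finite_setOf_eq_scale L.lat L₀.lat).image k)
    obtain ⟨c, hc, w, h1, h2⟩ := hy (Submodule.Quotient.mk ((d : K)⁻¹))
    refine hk c hc ?_
    obtain ⟨a, ha⟩ := KModO.eq_smul_inv hd (h0 _ ⟨c, hc, rfl⟩)
    rw [ha]
    refine ⟨a • w, KLattice.rep_smul h1 a, ?_⟩
    rw [mul_smul_comm]
    exact KLattice.rep_smul h2 a
  obtain ⟨c, hc, hB⟩ := hB
  refine hxy (LatticeSpace.mk_eq_mk_iff.2 ⟨c, KLattice.ext_rep hc fun k => ?_⟩)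
  obtain ⟨w, h1, h2⟩ := hB k
  exact ⟨c * w, h2, KLattice.smul_level_apply c L h1⟩

instance : T2Space (LatticeSpace K) := by
  refine ⟨fun x y hxy => ?_⟩
  obtain ⟨U, hU, hx, hy⟩ := LatticeSpace.exists_isClopen hxy
  exact ⟨U, Uᶜ, hU.2, hU.1.isOpen_compl, hx, hy, disjoint_compl_right⟩

end

/-! ### The `K`-lattices divisible by an integer -/

/-- Multiplication by a positive integer `n`. -/
def natUnit (n : ℕ) [NeZero n] : ℂˣ := Units.mk0 (n : ℂ) (NeZero.ne _)

variable (K) in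
/-- The classes of the `K`-lattices `(Λ, φ)` for which `φ` lifts to `n Λ`. -/
def divisible (n : ℕ) [NeZero n] : Set (LatticeSpace K) :=
  {x | ∃ L N : KLattice K, LatticeSpace.mk L = x ∧ L.Commensurable N ∧
    N.lat = L.lat.scale (natUnit n)}

theorem mk_mem_divisible {n : ℕ} [NeZero n] {L : KLattice K} :
    LatticeSpace.mk L ∈ divisible K n ↔
      ∃ N : KLattice K, L.Commensurable N ∧ N.lat = L.lat.scale (natUnit n) := by
  constructor
  · rintro ⟨M, N, hM, hN, hlat⟩
    obtain ⟨c, rfl⟩ := LatticeSpace.mk_eq_mk_iff.1 hM.symm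
    refine ⟨c • N, hN.smul c, ?_⟩
    rw [KLattice.smul_lat, KLattice.smul_lat, hlat, Lat.scale_scale, Lat.scale_scale, mul_comm]
  · rintro ⟨N, hN, hlat⟩
    exact ⟨L, N, rfl, hN, hlat⟩

theorem isClopen_divisible (n : ℕ) [NeZero n] : IsClopen (divisible K n) := by
  refine LatticeSpace.isClopen_of_forall fun Λ => ?_
  convert isClopen_extendable Λ (Λ.scale (natUnit n))
  ext φ
  refine mk_mem_divisible.trans ⟨?_, ?_⟩
  · rintro ⟨⟨Λ', φ'⟩, h, rfl⟩
    exact ⟨φ', h⟩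
  · rintro ⟨φ', h⟩
    exact ⟨⟨_, φ'⟩, h, rfl⟩

/-- The zero homomorphism lifts to every `n Λ`: the commensurable lattice is `(n Λ, 0)`. So all
points with isotropy lie in every divisible set. -/
theorem KLattice.mem_divisible_of_level_eq_zero {L : KLattice K} (h : L.level.1 = 0) (n : ℕ)
    [NeZero n] : LatticeSpace.mk L ∈ divisible K n := by
  refine mk_mem_divisible.2 ⟨⟨L.lat.scale (natUnit n), 0, fun x => ⟨0, zero_mem _, ?_⟩⟩, ?_, rfl⟩
  · rw [map_zero, LinearMap.zero_apply]
  · refine KLattice.commensurable_of_rep ?_ fun x => ⟨0, 0, ?_, ?_, by simp⟩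
    · exact (Lat.spanK_scale L.lat (k := (n : K)) (by simp [natUnit])).symm
    · rw [h, map_zero, LinearMap.zero_apply]
    · exact (map_zero (L.lat.scale (natUnit n)).carrier.mkQ).symm

/-- Outside of the classes of lattices divisible by `n`, the groupoid is principal. -/
theorem CommGroupoid.range_ne_source {γ : CommGroupoid K} {n : ℕ} [NeZero n]
    (hu : γ ∉ Set.range (unit : LatticeSpace K → CommGroupoid K))
    (hn : range γ ∉ divisible K n) : range γ ≠ source γ := by
  induction γ using ind with
  | h L M h =>
    intro heq
    rw [range_mk, source_mk] at heq
    obtain ⟨c, rfl⟩ := LatticeSpace.mk_eq_mk_iff.1 heq.symm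
    refine hn (KLattice.mem_divisible_of_level_eq_zero
      (KLattice.level_eq_zero_of_commensurable_smul h fun hc => hu ⟨LatticeSpace.mk L, ?_⟩) n)
    rw [unit_mk]
    simp only [hc]

theorem KLattice.exists_natUnit_enlarge (N : KLattice K) (n : ℕ) [NeZero n] :
    ∃ L : KLattice K, L.Commensurable N ∧ N.lat = L.lat.scale (natUnit n) := by
  have hle : N.lat.carrier ≤ (N.lat.scale (natUnit n)⁻¹).carrier := fun z hz => by
    rw [Lat.mem_scale_iff, inv_inv]
    have := Submodule.smul_mem N.lat.carrier (n : 𝓞 K) hz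
    rw [Algebra.smul_def, map_natCast] at this
    exact this
  obtain ⟨L, hL, h⟩ := N.exists_enlarge hle
    (Lat.spanK_scale N.lat (k := (n : K)⁻¹) (by simp [natUnit])).symm
  exact ⟨L, h.symm, by rw [hL, Lat.scale_scale, mul_inv_cancel, Lat.scale_one]⟩

end CMSystem

namespace CMSystem

/-! ### Matrix coefficients of operators on `ℓ²` -/

section Entries

variable {ι : Type*}

open Classical in
/-- The matrix coefficient `⟨δ_i, T δ_j⟩`. -/
def entry (T : lp (fun _ : ι => ℂ) 2 →L[ℂ] lp (fun _ : ι => ℂ) 2) (i j : ι) : ℂ :=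
  T (lp.single 2 j (1 : ℂ)) i

variable (T S : lp (fun _ : ι => ℂ) 2 →L[ℂ] lp (fun _ : ι => ℂ) 2)

theorem hasSum_entry (ξ : lp (fun _ : ι => ℂ) 2) (i : ι) :
    HasSum (fun j => entry T i j * ξ j) (T ξ i) := by
  classical
  have h := ((lp.hasSum_single (by simp) ξ).mapL T).mapL (lp.evalCLM ℂ (fun _ : ι => ℂ) 2 i)
  refine h.congr_fun fun j => ?_
  have : lp.single 2 j (ξ j) = ξ j • lp.single (E := fun _ : ι => ℂ) 2 j (1 : ℂ) := by
    rw [← lp.single_smul, smul_eq_mul, mul_one]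
  rw [this, map_smul, map_smul, smul_eq_mul, mul_comm, entry]
  congr!

variable {T S} in
theorem ext_entry (h : ∀ i j, entry T i j = entry S i j) : T = S := by
  refine ContinuousLinearMap.ext fun ξ => lp.ext (funext fun i => ?_)
  refine (hasSum_entry T ξ i).unique ?_
  simpa only [h] using hasSum_entry S ξ i

theorem entry_add (i j : ι) : entry (T + S) i j = entry T i j + entry S i j := rfl

theorem entry_sub (i j : ι) : entry (T - S) i j = entry T i j - entry S i j := rfl

theorem entry_smul (c : ℂ) (i j : ι) : entry (c • T) i j = c * entry T i j := rfl

theorem entry_star (i j : ι) : entry (star T) i j = star (entry T j i) := by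
  classical
  have h := ContinuousLinearMap.adjoint_inner_right T (lp.single 2 i (1 : ℂ))
    (lp.single 2 j (1 : ℂ))
  rw [lp.inner_single_left, lp.inner_single_right] at h
  simp only [RCLike.inner_apply, map_one, mul_one, one_mul] at h
  rw [entry, entry]
  convert h
  · rfl
  · rfl

theorem norm_entry_le (i j : ι) : ‖entry T i j‖ ≤ ‖T‖ := by
  classical
  refine (lp.norm_apply_le_norm (by simp) _ i).trans ((T.le_opNorm _).trans ?_)
  rw [lp.norm_single (by simp), norm_one, mul_one]

open Classical in
theorem entry_one (i j : ι) :
    entry (1 : lp (fun _ : ι => ℂ) 2 →L[ℂ] lp (fun _ : ι => ℂ) 2) i j = if i = j then 1 else 0 := by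
  rw [entry, one_apply_eq_self, lp.single_apply, Pi.single_apply]

theorem hasSum_entry_mul (i j : ι) :
    HasSum (fun k => entry T i k * entry S k j) (entry (T * S) i j) :=
  hasSum_entry T _ i

/-- The operator `ξ ↦ (i ↦ g i * ξ (θ i))`, for `g` bounded and `θ` injective. -/
def weightedComp (g : ι → ℂ) (θ : ι → ι) (hθ : Function.Injective θ) (C : ℝ)
    (hg : ∀ i, ‖g i‖ ≤ C) : lp (fun _ : ι => ℂ) 2 →L[ℂ] lp (fun _ : ι => ℂ) 2 :=
  have hs : ∀ ξ : lp (fun _ : ι => ℂ) 2, Summable fun i => ‖ξ (θ i)‖ ^ (2 : ENNReal).toReal :=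
    fun ξ => ((lp.memℓp ξ).summable (by simp)).comp_injective hθ
  have hle : ∀ (ξ : lp (fun _ : ι => ℂ) 2) (i : ι), ‖g i * ξ (θ i)‖ ^ (2 : ENNReal).toReal ≤
      |C| ^ (2 : ENNReal).toReal * ‖ξ (θ i)‖ ^ (2 : ENNReal).toReal := fun ξ i => by
    rw [← Real.mul_rpow (abs_nonneg C) (norm_nonneg _), norm_mul]
    gcongr
    exact (hg i).trans (le_abs_self C)
  have hs' : ∀ ξ : lp (fun _ : ι => ℂ) 2,
      Summable fun i => ‖g i * ξ (θ i)‖ ^ (2 : ENNReal).toReal := fun ξ =>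
    Summable.of_nonneg_of_le (fun _ => by positivity) (hle ξ) ((hs ξ).mul_left _)
  LinearMap.mkContinuous
    { toFun := fun ξ => ⟨fun i => g i * ξ (θ i), memℓp_gen (hs' ξ)⟩
      map_add' := fun ξ η => by
        ext i
        exact mul_add _ _ _
      map_smul' := fun c ξ => by
        ext i
        exact mul_left_comm _ _ _ }
    |C| fun ξ => by
      refine lp.norm_le_of_tsum_le (by simp) (by positivity) ?_
      rw [Real.mul_rpow (abs_nonneg _) (norm_nonneg _), lp.norm_rpow_eq_tsum (by simp)]
      refine ((hs' ξ).tsum_le_tsum (fun i => hle ξ i) ((hs ξ).mul_left _)).trans ?_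
      rw [tsum_mul_left]
      exact mul_le_mul_of_nonneg_left (tsum_comp_le_tsum_of_inj
        ((lp.memℓp ξ).summable (by simp)) (fun _ => by positivity) hθ) (by positivity)

open Classical in
theorem entry_weightedComp (g : ι → ℂ) (θ : ι → ι) (hθ : Function.Injective θ) (C : ℝ)
    (hg : ∀ i, ‖g i‖ ≤ C) (i j : ι) :
    entry (weightedComp g θ hθ C hg) i j = if θ i = j then g i else 0 := by
  change g i * (lp.single 2 j (1 : ℂ) : lp (fun _ : ι => ℂ) 2) (θ i) = _
  rw [lp.single_apply, Pi.single_apply]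
  split_ifs <;> simp

end Entries

variable {K : Type*} [Field K] [Algebra K ℂ] [NumberField K]

open CommGroupoid

/-! ### Left convolutions -/

/-- Applied to a basis vector, the convolution sum has one nonzero term, by `mk_left_injective`. The
coefficient does not depend on `M`: this is right invariance. -/
theorem IsLeftConvolution.entry_eq {f : CommGroupoid K → ℂ}
    {T : HilbertSpace K →L[ℂ] HilbertSpace K} (h : IsLeftConvolution f T) {L N M : KLattice K}
    (h1 : L.Commensurable N) (h2 : N.Commensurable M) (h3 : L.Commensurable M) :
    entry T (mk L M h3) (mk N M h2) = f (mk L N h1) := by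
  classical
  refine (h _ L M h3).unique ?_
  convert hasSum_single (⟨N, h1, h2⟩ : {N : KLattice K // L.Commensurable N ∧ N.Commensurable M})
    fun N' hN' => ?_ using 1
  · rw [lp.single_apply, Pi.single_eq_same, mul_one]
  · rw [lp.single_apply, Pi.single_apply, if_neg, mul_zero]
    exact fun heq => hN' (Subtype.ext (mk_left_injective heq))

theorem IsLeftConvolution.entry_eq_zero {f : CommGroupoid K → ℂ}
    {T : HilbertSpace K →L[ℂ] HilbertSpace K} (h : IsLeftConvolution f T) {γ γ' : CommGroupoid K}
    (hs : source γ ≠ source γ') : entry T γ γ' = 0 := by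
  classical
  induction γ using ind with
  | h L M hLM =>
    refine (h _ L M hLM).unique ?_
    convert hasSum_zero with N
    rw [lp.single_apply, Pi.single_apply, if_neg, mul_zero]
    rintro rfl
    exact hs rfl

/-- Turns operator identities into identities of matrix coefficients. An arrow with the same source
as `(L, M)` can be rescaled to end exactly at `M`, so the nonvanishing coefficients of a row are
indexed by lattices `N`. -/
theorem isLeftConvolution_of_entry {f : CommGroupoid K → ℂ}
    {T : HilbertSpace K →L[ℂ] HilbertSpace K}
    (h1 : ∀ L N M (h1 : L.Commensurable N) (h2 : N.Commensurable M) (h3 : L.Commensurable M),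
      entry T (mk L M h3) (mk N M h2) = f (mk L N h1))
    (h0 : ∀ γ γ', source γ ≠ source γ' → entry T γ γ' = 0) : IsLeftConvolution f T := by
  intro ξ L M hLM
  have hinj : Function.Injective
      fun N : {N : KLattice K // L.Commensurable N ∧ N.Commensurable M} => mk N.1 M N.2.2 :=
    fun N N' h => Subtype.ext (mk_left_injective h)
  have := (hinj.hasSum_iff fun γ' hγ' => ?_).2 (hasSum_entry T ξ (mk L M hLM))
  · refine this.congr_fun fun N => ?_
    rw [Function.comp_apply, h1 L N.1 M N.2.1 N.2.2]
  · rw [h0, zero_mul]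
    intro heq
    induction γ' using ind with
    | h N M' h' =>
      rw [source_mk, source_mk] at heq
      obtain ⟨c, rfl⟩ := LatticeSpace.mk_eq_mk_iff.1 heq
      refine hγ' ⟨⟨c • N, hLM.trans (h'.symm.smul c), h'.smul c⟩, ?_⟩
      exact mk_smul c h'

theorem IsLeftConvolution.unique {f : CommGroupoid K → ℂ}
    {T S : HilbertSpace K →L[ℂ] HilbertSpace K} (hT : IsLeftConvolution f T)
    (hS : IsLeftConvolution f S) : T = S :=
  ContinuousLinearMap.ext fun ξ => lp.ext (funext fun γ => by
    induction γ using ind with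
    | h L M h => exact (hT ξ L M h).unique (hS ξ L M h))

theorem IsLeftConvolution.entry_unit {f : CommGroupoid K → ℂ}
    {T : HilbertSpace K →L[ℂ] HilbertSpace K} (h : IsLeftConvolution f T) (x : LatticeSpace K) :
    entry T (unit x) (unit x) = f (unit x) := by
  induction x using LatticeSpace.ind with
  | h L => exact h.entry_eq _ _ _

theorem IsLeftConvolution.zero :
    IsLeftConvolution (fun _ : CommGroupoid K => 0) (0 : HilbertSpace K →L[ℂ] HilbertSpace K) :=
  isLeftConvolution_of_entry (fun _ _ _ _ _ _ => rfl) fun _ _ _ => rfl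

theorem IsLeftConvolution.add {f g : CommGroupoid K → ℂ}
    {T S : HilbertSpace K →L[ℂ] HilbertSpace K} (hT : IsLeftConvolution f T)
    (hS : IsLeftConvolution g S) : IsLeftConvolution (f + g) (T + S) :=
  isLeftConvolution_of_entry
    (fun L N M h1 h2 h3 => by rw [entry_add, hT.entry_eq h1 h2, hS.entry_eq h1 h2]; rfl)
    fun γ γ' h => by rw [entry_add, hT.entry_eq_zero h, hS.entry_eq_zero h, add_zero]

theorem IsLeftConvolution.smul {f : CommGroupoid K → ℂ} {T : HilbertSpace K →L[ℂ] HilbertSpace K}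
    (hT : IsLeftConvolution f T) (c : ℂ) : IsLeftConvolution (fun γ => c * f γ) (c • T) :=
  isLeftConvolution_of_entry (fun L N M h1 h2 h3 => by rw [entry_smul, hT.entry_eq h1 h2])
    fun γ γ' h => by rw [entry_smul, hT.entry_eq_zero h, mul_zero]

theorem IsLeftConvolution.star {f : CommGroupoid K → ℂ} {T : HilbertSpace K →L[ℂ] HilbertSpace K}
    (hT : IsLeftConvolution f T) :
    IsLeftConvolution (fun γ => Star.star (f (inv γ))) (Star.star T) :=
  isLeftConvolution_of_entry
    (fun L N M h1 h2 h3 => by rw [entry_star, hT.entry_eq h1.symm h3, inv_mk])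
    fun γ γ' h => by rw [entry_star, hT.entry_eq_zero h.symm, star_zero]

/-- Multiplication by a bounded function `g` on the ranges of arrows. -/
def mulRange (g : LatticeSpace K → ℂ) (C : ℝ) (hg : ∀ x, ‖g x‖ ≤ C) :
    HilbertSpace K →L[ℂ] HilbertSpace K :=
  weightedComp (fun γ => g (range γ)) id Function.injective_id C fun γ => hg (range γ)

open Classical in
theorem isLeftConvolution_mulRange (g : LatticeSpace K → ℂ) (C : ℝ) (hg : ∀ x, ‖g x‖ ≤ C) :
    IsLeftConvolution (fun γ => if γ ∈ Set.range (unit : LatticeSpace K → CommGroupoid K) then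
      g (range γ) else 0) (mulRange g C hg) := by
  refine isLeftConvolution_of_entry (fun L N M h1 h2 h3 => ?_) fun γ γ' h => ?_
  · rw [mulRange, entry_weightedComp, id, range_mk, range_mk]
    refine if_congr ⟨fun h => ?_, ?_⟩ rfl rfl
    · obtain rfl := mk_left_injective h
      exact ⟨LatticeSpace.mk L, rfl⟩
    · rintro ⟨x, hx⟩
      induction x using LatticeSpace.ind with
      | h P =>
        obtain ⟨c, rfl, hN⟩ := mk_eq_mk_iff.1 (hx.symm.trans (unit_mk P))
        subst hN
        rfl
  · rw [mulRange, entry_weightedComp, if_neg]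
    rintro rfl
    exact h rfl

open Classical in
theorem isLeftConvolution_one :
    IsLeftConvolution (fun γ => if γ ∈ Set.range (unit : LatticeSpace K → CommGroupoid K) then
      (1 : ℂ) else 0) (1 : HilbertSpace K →L[ℂ] HilbertSpace K) := by
  convert isLeftConvolution_mulRange (K := K) (fun _ => (1 : ℂ)) 1 (by simp)
  refine ext_entry fun γ γ' => ?_
  rw [entry_one, mulRange, entry_weightedComp, id]

theorem mulRange_mul_entry (g : LatticeSpace K → ℂ) (C : ℝ) (hg : ∀ x, ‖g x‖ ≤ C)
    (T : HilbertSpace K →L[ℂ] HilbertSpace K) (γ γ' : CommGroupoid K) :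
    entry (mulRange g C hg * T) γ γ' = g (range γ) * entry T γ γ' := rfl

theorem mul_mulRange_entry (g : LatticeSpace K → ℂ) (C : ℝ) (hg : ∀ x, ‖g x‖ ≤ C)
    (T : HilbertSpace K →L[ℂ] HilbertSpace K) (γ γ' : CommGroupoid K) :
    entry (T * mulRange g C hg) γ γ' = entry T γ γ' * g (range γ') := by
  classical
  refine (hasSum_entry_mul T _ γ γ').unique ?_
  convert hasSum_single γ' fun γ'' h => ?_ using 1
  · rw [mulRange, entry_weightedComp, id, if_pos rfl]
  · rw [mulRange, entry_weightedComp, id, if_neg h, mul_zero]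

/-! ### The algebra of left convolutions with continuous compactly supported functions -/

section Convolution

variable {f₁ f₂ f : CommGroupoid K → ℂ}

/-- `f` is the convolution product of `f₁` and `f₂`. -/
def IsConvolution (f₁ f₂ f : CommGroupoid K → ℂ) : Prop :=
  ∀ (L M : KLattice K) (h : L.Commensurable M),
    HasSum (fun N : {N : KLattice K // L.Commensurable N ∧ N.Commensurable M} =>
      f₁ (mk L N.1 N.2.1) * f₂ (mk N.1 M N.2.2)) (f (mk L M h))

open Classical in
/-- The term of index `Λ''` of a convolution product on the pairs of lattices `(Λ, Λ')`. -/
def convTerm (f₁ f₂ : CommGroupoid K → ℂ) {Λ Λ' : Lat K} (q : CommLevel Λ Λ') (Λ'' : Lat K) : ℂ :=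
  if hq : q.1.1 ∈ extendable Λ Λ'' then
    f₁ (mk ⟨Λ, q.1.1⟩ ⟨Λ'', extension ⟨_, hq⟩⟩ (commensurable_extension ⟨_, hq⟩)) *
      f₂ (mk ⟨Λ'', extension ⟨_, hq⟩⟩ ⟨Λ', q.1.2⟩
        ((commensurable_extension ⟨_, hq⟩).symm.trans q.2))
  else 0

/-- A lattice commensurable with `(Λ, φ)` is determined by its underlying `Λ''`, so the sum can be
indexed by the fixed set of all `Λ''`, independently of the level structures. Continuity can then be
studied term by term. -/
theorem IsConvolution.hasSum_convTerm (h : IsConvolution f₁ f₂ f) {Λ Λ' : Lat K}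
    (q : CommLevel Λ Λ') :
    HasSum (convTerm f₁ f₂ q) (f (mk ⟨Λ, q.1.1⟩ ⟨Λ', q.1.2⟩ q.2)) := by
  have hinj : Function.Injective fun N : {N : KLattice K //
      KLattice.Commensurable ⟨Λ, q.1.1⟩ N ∧ N.Commensurable ⟨Λ', q.1.2⟩} => N.1.lat :=
    fun N N' h => Subtype.ext ((N.2.1.symm.trans N'.2.1).eq_of_lat_eq h)
  refine (hinj.hasSum_iff fun Λ'' hΛ'' => ?_).1 ((h _ _ q.2).congr_fun fun N => ?_)
  · rw [convTerm, dif_neg]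
    rintro ⟨φ'', hφ''⟩
    exact hΛ'' ⟨⟨⟨Λ'', φ''⟩, hφ'', hφ''.symm.trans q.2⟩, rfl⟩
  · have hq : q.1.1 ∈ extendable Λ N.1.lat := ⟨N.1.level, N.2.1⟩
    have hN : (⟨N.1.lat, extension ⟨_, hq⟩⟩ : KLattice K) = N.1 :=
      ((commensurable_extension ⟨_, hq⟩).symm.trans N.2.1).eq_of_lat_eq rfl
    rw [Function.comp_apply, convTerm, dif_pos hq]
    simp only [hN]

theorem continuous_convTerm (h₁ : Continuous f₁) (h₂ : Continuous f₂) (Λ Λ' Λ'' : Lat K) :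
    Continuous fun q : CommLevel Λ Λ' => convTerm f₁ f₂ q Λ'' := by
  let S : Set (CommLevel Λ Λ') := {q | q.1.1 ∈ extendable Λ Λ''}
  have hS : IsClopen S := (isClopen_extendable Λ Λ'').preimage
    (continuous_fst.comp continuous_subtype_val)
  have he : Continuous fun q : S => extension (⟨q.1.1.1, q.2⟩ : extendable Λ Λ'') :=
    continuous_extension.comp (Continuous.subtype_mk (by fun_prop) _)
  refine continuous_iff_continuousAt.2 fun q => ?_
  by_cases hq : q ∈ S
  · refine ContinuousOn.continuousAt (s := S) ?_ (hS.2.mem_nhds hq)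
    refine continuousOn_iff_continuous_domRestrict.2 ?_
    have c1 : Continuous fun q : S => f₁ (mk ⟨Λ, q.1.1.1⟩ ⟨Λ'', extension ⟨_, q.2⟩⟩
        (commensurable_extension ⟨_, q.2⟩)) :=
      h₁.comp ((continuous_mk Λ Λ'').comp
        (g := fun q : CommLevel Λ Λ'' => mk ⟨Λ, q.1.1⟩ ⟨Λ'', q.1.2⟩ q.2)
        (f := fun q : S => (⟨(q.1.1.1, extension ⟨_, q.2⟩), commensurable_extension ⟨_, q.2⟩⟩ :
          CommLevel Λ Λ''))
        (Continuous.subtype_mk ((by fun_prop : Continuous fun q : S => q.1.1.1).prodMk he) _))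
    have c2 : Continuous fun q : S => f₂ (mk ⟨Λ'', extension ⟨_, q.2⟩⟩ ⟨Λ', q.1.1.2⟩
        ((commensurable_extension ⟨_, q.2⟩).symm.trans q.1.2)) :=
      h₂.comp ((continuous_mk Λ'' Λ').comp
        (g := fun q : CommLevel Λ'' Λ' => mk ⟨Λ'', q.1.1⟩ ⟨Λ', q.1.2⟩ q.2)
        (f := fun q : S => (⟨(extension ⟨_, q.2⟩, q.1.1.2),
          (commensurable_extension ⟨_, q.2⟩).symm.trans q.1.2⟩ : CommLevel Λ'' Λ'))
        (Continuous.subtype_mk (he.prodMk (by fun_prop : Continuous fun q : S => q.1.1.2)) _))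
    refine (c1.mul c2).congr fun q => ?_
    rw [Set.domRestrict_apply, convTerm,
      dif_pos (show q.1.1.1 ∈ extendable Λ Λ'' from q.2)]
    rfl
  · refine continuousAt_const.congr (f := fun _ => (0 : ℂ)) ?_
    filter_upwards [hS.1.isOpen_compl.mem_nhds hq] with q' hq'
    rw [convTerm, dif_neg]
    exact hq'

/-- Compact support of `f₁` leaves finitely many `Λ''` for a given `Λ`, the same for all level
structures, so on each chart the product is a finite sum of continuous terms. -/
theorem IsConvolution.continuous (h : IsConvolution f₁ f₂ f) (h₁ : Continuous f₁)
    (h₂ : Continuous f₂) (hc : HasCompactSupport f₁) : Continuous f := by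
  refine continuous_of_forall fun Λ Λ' => ?_
  obtain ⟨S, hS, hf⟩ := exists_finite_of_hasCompactSupport hc Λ
  have : ∀ q : CommLevel Λ Λ', f (mk ⟨Λ, q.1.1⟩ ⟨Λ', q.1.2⟩ q.2) =
      ∑ Λ'' ∈ hS.toFinset, convTerm f₁ f₂ q Λ'' := fun q => by
    refine (h.hasSum_convTerm q).unique (hasSum_sum_of_ne_finset_zero fun Λ'' hΛ'' => ?_)
    by_contra hne
    refine hΛ'' (hS.mem_toFinset.2 ?_)
    rw [convTerm] at hne
    split_ifs at hne with hq
    · exact hf _ _ _ rfl (left_ne_zero_of_mul hne)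
    · exact absurd rfl hne
  simp only [this]
  exact continuous_finsetSum _ fun Λ'' _ => continuous_convTerm h₁ h₂ Λ Λ' Λ''

theorem IsConvolution.hasCompactSupport (h : IsConvolution f₁ f₂ f) (hc₁ : HasCompactSupport f₁)
    (hc₂ : HasCompactSupport f₂) : HasCompactSupport f := by
  refine hasCompactSupport_of_exists_finite fun Λ => ?_
  obtain ⟨S, hS, hf⟩ := exists_finite_of_hasCompactSupport hc₁ Λ
  choose S₂ hS₂ hf₂ using exists_finite_of_hasCompactSupport hc₂
  refine ⟨⋃ Λ'' ∈ S, S₂ Λ'', hS.biUnion fun Λ'' _ => hS₂ Λ'', fun L M hLM hL hne => ?_⟩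
  by_contra hM
  refine hne ((h L M hLM).unique ?_)
  convert hasSum_zero with N
  by_contra hN
  refine hM (Set.mem_biUnion (x := N.1.lat) ?_ ?_)
  · exact hf _ _ _ hL (left_ne_zero_of_mul hN)
  · exact hf₂ _ _ _ _ rfl (right_ne_zero_of_mul hN)

end Convolution

/-- The product of two left convolutions is a left convolution. -/
theorem IsLeftConvolution.mul {f₁ f₂ : CommGroupoid K → ℂ}
    {T S : HilbertSpace K →L[ℂ] HilbertSpace K} (hT : IsLeftConvolution f₁ T)
    (hS : IsLeftConvolution f₂ S) :
    ∃ f, IsConvolution f₁ f₂ f ∧ IsLeftConvolution f (T * S) := by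
  classical
  have key : ∀ (L N M : KLattice K) (_ : L.Commensurable N) (h2 : N.Commensurable M)
      (h3 : L.Commensurable M),
      HasSum (fun P : {P : KLattice K // L.Commensurable P ∧ P.Commensurable N} =>
        f₁ (mk L P.1 P.2.1) * f₂ (mk P.1 N P.2.2)) (entry (T * S) (mk L M h3) (mk N M h2)) := by
    intro L N M h1 h2 h3
    have h := hT (S (lp.single 2 (mk N M h2) 1)) L M h3
    -- As `N` and `M` are commensurable, both index sets coincide; this is why the coefficient does
    -- not depend on `M`.
    let e : {P : KLattice K // L.Commensurable P ∧ P.Commensurable N} ≃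
        {P : KLattice K // L.Commensurable P ∧ P.Commensurable M} :=
      Equiv.subtypeEquivRight fun P => and_congr_right fun _ =>
        ⟨fun h => h.trans h2, fun h => h.trans h2.symm⟩
    refine (e.hasSum_iff.2 h).congr_fun fun P => ?_
    rw [Function.comp_apply]
    congr 1
    exact (hS.entry_eq P.2.2 h2 (P.2.2.trans h2)).symm
  have hf : ∀ L N (h : L.Commensurable N),
      entry (T * S) (mk L N h) (unit (source (mk L N h))) =
      entry (T * S) (mk L N h) (mk N N (.refl N)) := fun L N h => rfl
  refine ⟨fun γ => entry (T * S) γ (unit (source γ)), fun L M h => ?_,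
    isLeftConvolution_of_entry (fun L N M h1 h2 h3 => ?_) fun γ γ' h => ?_⟩
  · exact key L M M h (.refl M) h
  · rw [hf]
    exact (key L N M h1 h2 h3).unique (key L N N h1 (.refl N) h1)
  · refine (hasSum_entry_mul T S γ γ').unique ?_
    convert hasSum_zero with γ''
    by_cases h' : source γ = source γ''
    · rw [hS.entry_eq_zero (h' ▸ h), mul_zero]
    · rw [hT.entry_eq_zero h', zero_mul]

open Classical in
theorem continuous_unit_indicator (g : C(LatticeSpace K, ℂ)) :
    Continuous fun γ => if γ ∈ Set.range (unit : LatticeSpace K → CommGroupoid K) then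
      g (range γ) else 0 :=
  (g.continuous.comp continuous_range).if (fun a ha => by
    have := isClopen_range_unit (K := K).frontier_eq
    simp only [Set.ofPred_mem_eq] at ha
    rw [this] at ha
    exact ha.elim) continuous_const

-- The units form a compact clopen set because `X` is compact; this places `C(X)`, and in particular
-- the identity, in the algebra.
open Classical in
theorem hasCompactSupport_unit_indicator (g : LatticeSpace K → ℂ) :
    HasCompactSupport fun γ => if γ ∈ Set.range (unit : LatticeSpace K → CommGroupoid K) then
      g (range γ) else 0 :=
  HasCompactSupport.intro' (isCompact_range continuous_unit) isClopen_range_unit.1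
    fun _ hγ => if_neg hγ

theorem hasCompactSupport_comp_inv {f : CommGroupoid K → ℂ} (hf : HasCompactSupport f) :
    HasCompactSupport (f ∘ inv) :=
  hf.comp_homeomorph ⟨⟨inv, inv, inv_inv, inv_inv⟩, continuous_inv, continuous_inv⟩

variable (K) in
/-- The `*`-algebra of left convolutions with continuous functions with compact support. -/
def convAlgebra : StarSubalgebra ℂ (HilbertSpace K →L[ℂ] HilbertSpace K) where
  carrier := {T | ∃ f : CommGroupoid K → ℂ, Continuous f ∧ HasCompactSupport f ∧
    IsLeftConvolution f T}
  mul_mem' := by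
    rintro T S ⟨f₁, h₁, c₁, hT⟩ ⟨f₂, h₂, c₂, hS⟩
    obtain ⟨f, hf, hTS⟩ := hT.mul hS
    exact ⟨f, hf.continuous h₁ h₂ c₁, hf.hasCompactSupport c₁ c₂, hTS⟩
  add_mem' := by
    rintro T S ⟨f₁, h₁, c₁, hT⟩ ⟨f₂, h₂, c₂, hS⟩
    exact ⟨f₁ + f₂, h₁.add h₂, c₁.add c₂, hT.add hS⟩
  algebraMap_mem' c := by
    classical
    rw [Algebra.algebraMap_eq_smul_one]
    refine ⟨_, continuous_const.mul (continuous_unit_indicator 1),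
      (hasCompactSupport_unit_indicator fun _ => 1).mul_left, isLeftConvolution_one.smul c⟩
  star_mem' := by
    rintro T ⟨f, hf, hc, hT⟩
    exact ⟨_, (hf.comp continuous_inv).star, (hasCompactSupport_comp_inv hc).comp_left (star_zero _), hT.star⟩

theorem mem_convAlgebra {T : HilbertSpace K →L[ℂ] HilbertSpace K} :
    T ∈ convAlgebra K ↔ ∃ f : CommGroupoid K → ℂ, Continuous f ∧ HasCompactSupport f ∧
      IsLeftConvolution f T := Iff.rfl

theorem convAlgebra_le : convAlgebra K ≤ CMAlgebra K :=
  fun _ hT => StarSubalgebra.le_topologicalClosure _ (StarAlgebra.subset_adjoin ℂ _ hT)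

theorem CMAlgebra_eq : CMAlgebra K = (convAlgebra K).topologicalClosure := by
  refine le_antisymm (StarSubalgebra.topologicalClosure_mono (StarAlgebra.adjoin_le fun _ h => h))
    ?_
  exact StarSubalgebra.topologicalClosure_mono fun _ hT => StarAlgebra.subset_adjoin ℂ _ hT

end CMSystem

namespace CMSystem

/-! ### States and the KMS condition -/

section States

/-- A bounded holomorphic function on a strip that vanishes on one edge vanishes on the other. -/
theorem eq_zero_of_strip {β : ℝ} (hβ : 0 < β) {H : ℂ → ℂ}
    (hd : DifferentiableOn ℂ H {z | 0 < z.im ∧ z.im < β})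
    (hc : ContinuousOn H {z | 0 ≤ z.im ∧ z.im ≤ β})
    (hb : ∃ C : ℝ, ∀ z : ℂ, 0 ≤ z.im → z.im ≤ β → ‖H z‖ ≤ C) (h0 : ∀ t : ℝ, H t = 0) :
    H (Complex.I * β) = 0 := by
  obtain ⟨C, hC⟩ := hb
  have him : ∀ w : ℂ, (Complex.I * β * w).im = β * w.re := fun w => by simp
  have hcont : Continuous fun w : ℂ => Complex.I * β * w := by fun_prop
  have hcl : closure (Complex.HadamardThreeLines.verticalStrip 0 1) =
      Complex.HadamardThreeLines.verticalClosedStrip 0 1 := by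
    rw [Complex.HadamardThreeLines.verticalStrip, Complex.HadamardThreeLines.verticalClosedStrip,
      Complex.closure_preimage_re, closure_Ioo zero_ne_one]
  have key : ∀ s : ℝ, 0 ≤ s → s < 1 → H (Complex.I * β * s) = 0 := by
    intro s hs0 hs1
    -- The substitution `z = iβw` turns the strip into `0 ≤ Re w ≤ 1`. With bound `0` on the left
    -- edge, the three lines estimate is `0^(1-s) C^s`, which is zero only for `s < 1`; the edge `s
    -- = 1` is reached by continuity below.
    have := Complex.HadamardThreeLines.norm_le_interp_of_mem_verticalClosedStrip₀₁'
      (fun w => H (Complex.I * β * w)) (z := (s : ℂ)) (a := 0) (b := C) ?_ ⟨?_, ?_⟩ ?_ ?_ ?_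
    · rw [Complex.ofReal_re, Real.zero_rpow (by linarith), zero_mul] at this
      exact norm_le_zero_iff.1 this
    · exact ⟨by simpa using hs0, by simpa using hs1.le⟩
    · refine hd.comp (by fun_prop) fun w hw => ?_
      have hw : 0 < w.re ∧ w.re < 1 := hw
      exact ⟨by rw [him]; nlinarith, by rw [him]; nlinarith⟩
    · rw [hcl]
      refine hc.comp hcont.continuousOn fun w hw => ?_
      have hw : 0 ≤ w.re ∧ w.re ≤ 1 := hw
      exact ⟨by rw [him]; nlinarith, by rw [him]; nlinarith⟩
    · refine ⟨C, ?_⟩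
      rintro _ ⟨w, hw, rfl⟩
      have hw : 0 ≤ w.re ∧ w.re ≤ 1 := hw
      exact hC _ (by rw [him]; nlinarith) (by rw [him]; nlinarith)
    · intro w hw
      have hw : w.re = 0 := hw
      have : Complex.I * β * w = ((-(β * w.im) : ℝ) : ℂ) := by
        apply Complex.ext <;> simp [hw]
      change ‖H (Complex.I * β * w)‖ ≤ 0
      rw [this, h0, norm_zero]
    · intro w hw
      have hw : w.re = 1 := hw
      exact hC _ (by rw [him]; nlinarith) (by rw [him]; nlinarith)
  have hline : Set.EqOn (fun s : ℝ => H (Complex.I * β * s)) (fun _ => 0) (Set.Icc 0 1) := by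
    refine Set.EqOn.of_subset_closure (s := Set.Ico 0 1) (fun s hs => key s hs.1 hs.2) ?_
      continuousOn_const Set.Ico_subset_Icc_self (closure_Ico (zero_ne_one' ℝ)).ge
    refine hc.comp (by fun_prop) fun s hs => ?_
    refine ⟨?_, ?_⟩ <;> rw [him, Complex.ofReal_re] <;> nlinarith [hs.1, hs.2]
  simpa using hline (Set.right_mem_Icc.2 zero_le_one)

/-- The KMS condition for an eigenvector of the time evolution. -/
theorem IsKMSState.apply_mul {A : Type*} [Ring A] [StarRing A] [Algebra ℂ A] {σ : ℝ → A → A}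
    {β : ℝ} (hβ : 0 < β) {φ : A →ₗ[ℂ] ℂ} (h : IsKMSState σ β φ) {y : A} {l : ℝ}
    (hy : ∀ t, σ t y = Complex.exp (Complex.I * t * l) • y) (x : A) :
    φ (y * x) = Complex.exp (-(β * l)) * φ (x * y) := by
  obtain ⟨F, hd, ⟨C, hC⟩, hc, hF⟩ := h.kms x y
  simp only [hy, mul_smul_comm, smul_mul_assoc, map_smul, smul_eq_mul] at hF
  have hexp : ∀ t : ℝ, ‖Complex.exp (Complex.I * t * l)‖ = 1 := fun t => by
    rw [Complex.norm_exp]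
    simp
  -- The function `exp(ilz) φ(xy)` is the explicit analytic continuation of `φ(x σ_t(y))`. It agrees
  -- with `F` on the real line, hence also at `iβ`.
  have hH := eq_zero_of_strip hβ (H := fun z => F z - Complex.exp (Complex.I * z * l) * φ (x * y))
    (hd.sub (by fun_prop)) (hc.sub (by fun_prop))
    -- `C` bounds `F` in the interior, the two norms bound it on the edges, and `exp(β |l|)` bounds
    -- the exponential on the closed strip.
    ⟨max C (max ‖φ (x * y)‖ ‖φ (y * x)‖) + Real.exp (β * |l|) * ‖φ (x * y)‖, fun z h0 h1 => ?_⟩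
    fun t => ?_
  · have := (hF 0).2
    simp only [Complex.ofReal_zero, zero_add, mul_zero, zero_mul, Complex.exp_zero, one_mul] at this
    simp only [this] at hH
    rw [sub_eq_zero.1 hH, ← mul_assoc, Complex.I_mul_I, neg_one_mul, neg_mul]
  · refine (norm_sub_le _ _).trans (add_le_add ?_ ?_)
    · rcases h0.eq_or_lt with h0 | h0
      · have hz : z = (z.re : ℂ) := by apply Complex.ext <;> simp [← h0]
        rw [hz, (hF z.re).1, norm_mul, hexp, one_mul]
        exact (le_max_left _ _).trans (le_max_right _ _)
      rcases h1.eq_or_lt with h1 | h1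
      · have hz : z = (z.re : ℂ) + Complex.I * β := by apply Complex.ext <;> simp [← h1]
        rw [hz, (hF z.re).2, norm_mul, hexp, one_mul]
        exact (le_max_right _ _).trans (le_max_right _ _)
      · exact (hC z h0 h1).trans (le_max_left _ _)
    · rw [norm_mul, Complex.norm_exp]
      gcongr
      have : (Complex.I * z * l).re = z.im * -l := by simp
      rw [this]
      exact (mul_le_mul_of_nonneg_left (neg_le_abs l) h0).trans
        (mul_le_mul_of_nonneg_right h1 (abs_nonneg l))
  · simp only [(hF t).1, sub_self]

variable {A : Type*} [CStarAlgebra A] {φ : A →ₗ[ℂ] ℂ}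

open scoped ComplexOrder in
theorem IsState.exists_positiveLinearMap [PartialOrder A] [StarOrderedRing A] (h : IsState φ) :
    ∃ ψ : A →ₚ[ℂ] ℂ, ∀ a, ψ a = φ a :=
  ⟨PositiveLinearMap.mk₀ φ fun a ha => by
    obtain ⟨b, rfl⟩ := CStarAlgebra.nonneg_iff_eq_star_mul_self.1 ha
    exact h.nonneg b, fun _ => rfl⟩

open scoped ComplexOrder in
theorem IsState.exists_norm_le (h : IsState φ) : ∃ C : ℝ, ∀ a, ‖φ a‖ ≤ C * ‖a‖ := by
  let _ := CStarAlgebra.spectralOrder A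
  have := CStarAlgebra.spectralOrderedRing A
  obtain ⟨ψ, hψ⟩ := h.exists_positiveLinearMap
  obtain ⟨C, hC⟩ := ψ.exists_norm_apply_le
  exact ⟨C, fun a => hψ a ▸ hC a⟩

open scoped ComplexOrder in
-- Cauchy–Schwarz for the GNS semi-inner product `φ(x* y)`.
theorem IsState.norm_apply_star_mul_le (h : IsState φ) (x y : A) :
    ‖φ (star x * y)‖ ≤ √(φ (star x * x)).re * √(φ (star y * y)).re := by
  let _ := CStarAlgebra.spectralOrder A
  have := CStarAlgebra.spectralOrderedRing A
  obtain ⟨ψ, hψ⟩ := h.exists_positiveLinearMap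
  have := norm_inner_le_norm (𝕜 := ℂ) (ψ.toPreGNS x) (ψ.toPreGNS y)
  rw [PositiveLinearMap.preGNS_inner_def, PositiveLinearMap.preGNS_norm_def,
    PositiveLinearMap.preGNS_norm_def] at this
  simpa only [PositiveLinearMap.ofPreGNS_toPreGNS, hψ] using this

end States

variable {K : Type*} [Field K] [Algebra K ℂ] [NumberField K]

open CommGroupoid

/-! ### The isometries attached to the integers -/

/-- The image of a `K`-lattice `(Λ, φ)` over `n⁻¹ Λ`. -/
def KLattice.enlarge (n : ℕ) [NeZero n] (N : KLattice K) : KLattice K :=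
  (N.exists_natUnit_enlarge n).choose

section Enlarge

variable (n : ℕ) [NeZero n]

theorem KLattice.enlarge_commensurable (N : KLattice K) : (N.enlarge n).Commensurable N :=
  (N.exists_natUnit_enlarge n).choose_spec.1

theorem KLattice.lat_eq_scale_enlarge (N : KLattice K) :
    N.lat = (N.enlarge n).lat.scale (natUnit n) :=
  (N.exists_natUnit_enlarge n).choose_spec.2

theorem KLattice.eq_enlarge {n : ℕ} [NeZero n] {L N : KLattice K} (h : L.Commensurable N)
    (hl : N.lat = L.lat.scale (natUnit n)) : L = N.enlarge n :=
  (h.trans (N.enlarge_commensurable n).symm).eq_of_lat_eq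
    (Lat.scale_injective (natUnit n) (hl.symm.trans (N.lat_eq_scale_enlarge n)))

theorem KLattice.smul_enlarge (c : ℂˣ) (N : KLattice K) : c • N.enlarge n = (c • N).enlarge n := by
  refine KLattice.eq_enlarge ((N.enlarge_commensurable n).smul c) ?_
  rw [KLattice.smul_lat, KLattice.smul_lat]
  conv_lhs => rw [N.lat_eq_scale_enlarge n]
  rw [Lat.scale_scale, Lat.scale_scale, mul_comm]

/-- The map `(N, M) ↦ (N', M)` where `N'` is the image of `N` over `n⁻¹ Λ`. -/
def enlargeRange (γ : CommGroupoid K) : CommGroupoid K :=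
  Quotient.lift (fun p : CommPair K => CommGroupoid.mk (p.1.1.enlarge n) p.1.2
    ((p.1.1.enlarge_commensurable n).trans p.2)) (by
    rintro p q ⟨c, rfl⟩
    exact mk_eq_mk_iff.2 ⟨c, (KLattice.smul_enlarge n c q.1.1).symm, rfl⟩) γ

theorem enlargeRange_mk {N M : KLattice K} (h : N.Commensurable M) :
    enlargeRange n (mk N M h) = mk (N.enlarge n) M ((N.enlarge_commensurable n).trans h) := rfl

theorem enlargeRange_injective : Function.Injective (enlargeRange n : CommGroupoid K → _) := by
  intro γ γ' h
  induction γ using ind with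
  | h N M hN =>
  induction γ' using ind with
  | h N' M' hN' =>
    rw [enlargeRange_mk, enlargeRange_mk, mk_eq_mk_iff] at h
    obtain ⟨c, h1, rfl⟩ := h
    refine mk_eq_mk_iff.2 ⟨c, ?_, rfl⟩
    rw [KLattice.smul_enlarge] at h1
    refine (hN.trans (hN'.smul c).symm).eq_of_lat_eq ?_
    rw [N.lat_eq_scale_enlarge n, h1, ← (c • N').lat_eq_scale_enlarge n]

/-- An arrow comes from `(N, M)` exactly when its range lattice admits a commensurable lattice over
`n Λ`, namely `N`. This identifies the projection `w* w`. -/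
theorem mem_range_enlargeRange {γ : CommGroupoid K} :
    γ ∈ Set.range (enlargeRange n : CommGroupoid K → _) ↔ range γ ∈ divisible K n := by
  induction γ using ind with
  | h L M h =>
    rw [range_mk, mk_mem_divisible]
    constructor
    · rintro ⟨γ', hγ'⟩
      induction γ' using ind with
      | h N' M' h' =>
        rw [enlargeRange_mk] at hγ'
        obtain ⟨c, rfl, rfl⟩ := mk_eq_mk_iff.1 hγ'.symm
        refine ⟨c • N', (N'.enlarge_commensurable n).smul c, ?_⟩
        rw [KLattice.smul_enlarge]
        exact (c • N').lat_eq_scale_enlarge n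
    · rintro ⟨N, hN, hlat⟩
      refine ⟨mk N M (hN.symm.trans h), ?_⟩
      rw [enlargeRange_mk]
      simp only [← KLattice.eq_enlarge hN hlat]

theorem enlargeRange_mem_range_unit {L N : KLattice K} (h : N.Commensurable L) :
    enlargeRange n (mk N L h) ∈ Set.range (unit : LatticeSpace K → CommGroupoid K) ↔
      N.lat = L.lat.scale (natUnit n) := by
  rw [enlargeRange_mk]
  constructor
  · rintro ⟨x, hx⟩
    induction x using LatticeSpace.ind with
    | h P =>
      obtain ⟨c, h1, h2⟩ := mk_eq_mk_iff.1 hx.symm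
      rw [N.lat_eq_scale_enlarge n, h1, h2]
  · intro hl
    have := KLattice.eq_enlarge h.symm hl
    refine ⟨LatticeSpace.mk L, ?_⟩
    rw [unit_mk]
    simp only [← this]

variable (K) in
/-- The operator of composition with `(N, M) ↦ (N', M)`: it is the adjoint of an isometry. -/
def enlargeOp : HilbertSpace K →L[ℂ] HilbertSpace K :=
  weightedComp (fun _ => 1) (enlargeRange n) (enlargeRange_injective n) 1 (by simp)

open Classical in
theorem entry_enlargeOp (γ γ' : CommGroupoid K) :
    entry (enlargeOp K n) γ γ' = if enlargeRange n γ = γ' then 1 else 0 :=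
  entry_weightedComp _ _ _ _ _ _ _

open Classical in
theorem isLeftConvolution_enlargeOp : IsLeftConvolution
    (fun γ => if enlargeRange n γ ∈ Set.range (unit : LatticeSpace K → CommGroupoid K)
      then (1 : ℂ) else 0) (enlargeOp K n) := by
  refine isLeftConvolution_of_entry (fun L N M h1 h2 h3 => ?_) fun γ γ' h => ?_
  · rw [entry_enlargeOp, enlargeRange_mk]
    refine if_congr ?_ rfl rfl
    rw [enlargeRange_mem_range_unit]
    constructor
    · intro h
      rw [← mk_left_injective h]
      exact L.lat_eq_scale_enlarge n
    · intro h
      simp only [← KLattice.eq_enlarge h1.symm h]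
  · rw [entry_enlargeOp, if_neg]
    rintro rfl
    refine h ?_
    induction γ using ind with
    | h L M hLM => rfl

theorem enlargeOp_mem : enlargeOp K n ∈ CMAlgebra K := by
  classical
  refine convAlgebra_le (mem_convAlgebra.2 ⟨_, ?_, ?_, isLeftConvolution_enlargeOp n⟩)
  · refine continuous_of_forall fun Λ Λ' => ?_
    simp only [enlargeRange_mem_range_unit]
    exact continuous_const
  · refine hasCompactSupport_of_exists_finite fun Λ =>
      ⟨{Λ' | Λ = Λ'.scale (natUnit n)}, Set.Subsingleton.finite fun Λ₁ h₁ Λ₂ h₂ =>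
        Lat.scale_injective _ (h₁.symm.trans h₂), fun L M h hL hne => ?_⟩
    rw [ne_eq, ite_eq_right_iff, not_forall] at hne
    have := (enlargeRange_mem_range_unit n h).1 hne.choose
    rw [← hL]
    exact this

/-- Composition with an injective map is a coisometry: its adjoint pushes basis vectors forward
along that map. -/
theorem enlargeOp_mul_star : enlargeOp K n * star (enlargeOp K n) = 1 := by
  classical
  refine ext_entry fun γ γ' => (hasSum_entry_mul _ _ γ γ').unique ?_
  convert hasSum_single (enlargeRange n γ) fun γ'' h => ?_ using 1
  · rw [entry_star, entry_enlargeOp, entry_enlargeOp, entry_one, if_pos rfl, one_mul]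
    rw [(enlargeRange_injective n).eq_iff]
    by_cases h : γ = γ'
    · simp [h]
    · simp [h, Ne.symm h]
  · rw [entry_enlargeOp, if_neg h.symm, zero_mul]

end Enlarge

/-- The projection given by the indicator function of a set of ranges. -/
def rangeProj (U : Set (LatticeSpace K)) : HilbertSpace K →L[ℂ] HilbertSpace K :=
  mulRange (U.indicator 1) 1 fun x => by
    refine (norm_indicator_le_norm_self _ _).trans ?_
    simp

theorem star_mul_enlargeOp (n : ℕ) [NeZero n] :
    star (enlargeOp K n) * enlargeOp K n = rangeProj (divisible K n) := by
  classical
  refine ext_entry fun γ γ' => (hasSum_entry_mul _ _ γ γ').unique ?_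
  rw [rangeProj, mulRange, entry_weightedComp, id]
  simp only [entry_star, entry_enlargeOp]
  by_cases hγ : range γ ∈ divisible K n
  · rw [Set.indicator_of_mem hγ]
    obtain ⟨k, rfl⟩ := (mem_range_enlargeRange n).2 hγ
    convert hasSum_single k fun k' h => ?_ using 1
    · simp
    · rw [if_neg fun h' => h (enlargeRange_injective n h'), star_zero, zero_mul]
  · rw [Set.indicator_of_notMem hγ, ite_self]
    convert hasSum_zero with k
    rw [if_neg, star_zero, zero_mul]
    rintro rfl
    exact hγ ((mem_range_enlargeRange n).1 ⟨k, rfl⟩)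

theorem mulRange_mem_convAlgebra (g : C(LatticeSpace K, ℂ)) (C : ℝ) (hg : ∀ x, ‖g x‖ ≤ C) :
    mulRange g C hg ∈ convAlgebra K := by
  classical
  exact ⟨_, continuous_unit_indicator g, hasCompactSupport_unit_indicator g,
    isLeftConvolution_mulRange g C hg⟩

theorem rangeProj_mem {U : Set (LatticeSpace K)} (hU : IsClopen U) :
    rangeProj U ∈ convAlgebra K := by
  have hc : Continuous (U.indicator (1 : LatticeSpace K → ℂ)) :=
    continuous_const.indicator fun x hx => by
      rw [hU.frontier_eq] at hx
      exact hx.elim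
  exact mulRange_mem_convAlgebra ⟨_, hc⟩ 1 _

/-! ### Eigenvectors of the time evolution and their KMS relations -/

section Evolution

variable [Algebra.IsQuadraticExtension ℚ K] [IsTotallyComplex K]

theorem timeEvolution_eq_smul {f : CommGroupoid K → ℂ} 
    {T : HilbertSpace K →L[ℂ] HilbertSpace K} (h : IsLeftConvolution f T) {a : CMAlgebra K}
    (ha : a.1 = T) {t : ℝ} {c : ℂ} (hc : ∀ γ, phase t γ * f γ = c * f γ) :
    timeEvolution t a = c • a := by
  subst ha
  refine Subtype.ext ((h.conj t).unique ?_)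
  simp only [hc]
  exact h.smul c

theorem phase_unit (t : ℝ) (x : LatticeSpace K) : phase t (unit x) = 1 := by
  induction x using LatticeSpace.ind with
  | h L =>
    rw [unit_mk, phase, ratio_mk, div_self L.lat.covolume_pos.ne', Complex.ofReal_one,
      Complex.one_cpow]

theorem timeEvolution_mulRange {g : LatticeSpace K → ℂ} {C : ℝ} {hg : ∀ x, ‖g x‖ ≤ C}
    {a : CMAlgebra K} (ha : a.1 = mulRange g C hg) (t : ℝ) : timeEvolution t a = a := by
  classical
  rw [timeEvolution_eq_smul (isLeftConvolution_mulRange g C hg) ha (c := 1), one_smul]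
  intro γ
  split_ifs with h
  · obtain ⟨x, rfl⟩ := h
    rw [phase_unit]
  · simp

theorem timeEvolution_enlargeOp (n : ℕ) [NeZero n] {a : CMAlgebra K} (ha : a.1 = enlargeOp K n)
    (t : ℝ) : timeEvolution t a =
      Complex.exp (Complex.I * t * ((-(2 * Real.log n) : ℝ) : ℂ)) • a := by
  classical
  refine timeEvolution_eq_smul (isLeftConvolution_enlargeOp n) ha fun γ => ?_
  induction γ using ind with
  | h N L h =>
    simp only [enlargeRange_mem_range_unit]
    split_ifs with hl
    · have hn : (0 : ℝ) < n := Nat.cast_pos.2 (NeZero.pos n)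
      -- On the support `N` lies over `n Λ`, whose covolume is `n²` times that of `Λ`; hence the
      -- eigenvalue `n^(-2it)`.
      have : ratio (mk N L h) = Real.exp (-(2 * Real.log n)) := by
        rw [ratio_mk, hl, covolume_scale, Real.exp_neg, mul_comm 2, Real.exp_mul,
          Real.exp_log hn, Real.rpow_ofNat]
        have := L.lat.covolume_pos.ne'
        simp only [natUnit, Units.val_mk0, Complex.norm_natCast]
        field_simp
      rw [phase, this, Complex.ofReal_exp, Complex.cpow_def_of_ne_zero (Complex.exp_ne_zero _),
        ← Complex.ofReal_exp, ← Complex.ofReal_log (Real.exp_pos _).le, Real.log_exp,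
        mul_comm ((-(2 * Real.log n) : ℝ) : ℂ)]
    · simp

variable {β : ℝ} {φ : CMAlgebra K →ₗ[ℂ] ℂ}

/-- A KMS state is a trace on the diagonal. -/
theorem IsKMSState.mulRange_comm (hβ : 0 < β) (hφ : IsKMSState timeEvolution β φ)
    {g : LatticeSpace K → ℂ} {C : ℝ} {hg : ∀ x, ‖g x‖ ≤ C} {a : CMAlgebra K}
    (ha : a.1 = mulRange g C hg) (x : CMAlgebra K) : φ (a * x) = φ (x * a) := by
  have := hφ.apply_mul hβ (y := a) (l := 0) (fun t => by
    rw [timeEvolution_mulRange ha]; simp) x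
  simpa using this

/-- The mass of the lattices divisible by `n` is `n ^ (-2 β)`. -/
theorem IsKMSState.apply_divisible (hβ : 0 < β) (hφ : IsKMSState timeEvolution β φ) (n : ℕ)
    [NeZero n] {p : CMAlgebra K} (hp : p.1 = rangeProj (divisible K n)) :
    (φ p).re = Real.exp (-(2 * β * Real.log n)) := by
  set w : CMAlgebra K := ⟨enlargeOp K n, enlargeOp_mem n⟩
  have h1 : w * star w = 1 := Subtype.ext (enlargeOp_mul_star n)
  have h2 : star w * w = p := Subtype.ext ((star_mul_enlargeOp n).trans hp.symm)
  -- With `l = -2 log n` the relation becomes `φ(w w*) = n^(2β) φ(w* w)`, that is `1 = n^(2β) φ(p)`.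
  have := hφ.apply_mul hβ (timeEvolution_enlargeOp n (a := w) rfl) (star w)
  rw [h1, h2, hφ.map_one] at this
  have h3 : φ p = ((Real.exp (-(2 * β * Real.log n)) : ℝ) : ℂ) := by
    rw [Complex.ofReal_exp, ← mul_one (Complex.exp _), this, ← mul_assoc, ← Complex.exp_add]
    have : ((-(2 * β * Real.log n) : ℝ) : ℂ) + -((β : ℂ) * ((-(2 * Real.log n) : ℝ) : ℂ)) = 0 := by
      push_cast
      ring
    rw [this, Complex.exp_zero, one_mul]
  rw [h3, Complex.ofReal_re]

end Evolution

end CMSystem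

namespace CMSystem

variable {K : Type*} [Field K] [Algebra K ℂ] [NumberField K]

open CommGroupoid

/-! ### Vanishing of KMS states off the diagonal -/

variable (K) in
/-- `A_K` is a C*-algebra. -/
abbrev CMAlgebra.cstarAlgebra : CStarAlgebra (CMAlgebra K) :=
  StarSubalgebra.cstarAlgebra _ (h_closed := StarSubalgebra.isClosed_topologicalClosure _)

theorem star_rangeProj (U : Set (LatticeSpace K)) : star (rangeProj U) = rangeProj U := by
  classical
  refine ext_entry fun γ γ' => ?_
  rw [entry_star, rangeProj, mulRange, entry_weightedComp, entry_weightedComp, id, id]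
  by_cases h : γ = γ'
  · subst h
    by_cases hU : range γ ∈ U <;> simp [hU]
  · rw [if_neg h, if_neg (Ne.symm h), star_zero]

theorem rangeProj_mul_self (U : Set (LatticeSpace K)) :
    rangeProj U * rangeProj U = rangeProj U := by
  classical
  refine ext_entry fun γ γ' => ?_
  conv_lhs => rw [rangeProj, mulRange_mul_entry, mulRange, entry_weightedComp]
  rw [rangeProj, mulRange, entry_weightedComp]
  by_cases hU : range γ ∈ U <;> simp [hU]

section Vanishing

variable [Algebra.IsQuadraticExtension ℚ K] [IsTotallyComplex K]
variable {β : ℝ} {φ : CMAlgebra K →ₗ[ℂ] ℂ}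

/-- The value of a KMS state on a convolution only depends on the arrows that preserve a given
open and closed subset of `X`. -/
theorem IsKMSState.exists_restrict (hβ : 0 < β) (hφ : IsKMSState timeEvolution β φ)
    {U : Set (LatticeSpace K)} (hU : IsClopen U) {f : CommGroupoid K → ℂ} {a : CMAlgebra K}
    (ha : IsLeftConvolution f a.1) :
    ∃ (f' : CommGroupoid K → ℂ) (a' : CMAlgebra K), IsLeftConvolution f' a'.1 ∧ φ a' = φ a ∧
      ∀ γ, f' γ ≠ 0 → f γ ≠ 0 ∧ (range γ ∈ U ↔ source γ ∈ U) := by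
  classical
  let p : CMAlgebra K := ⟨rangeProj U, convAlgebra_le (rangeProj_mem hU)⟩
  have hpp : p * p = p := Subtype.ext (rangeProj_mul_self U)
  have hcomm : ∀ x, φ (p * x) = φ (x * p) := hφ.mulRange_comm hβ (a := p) (rangeProj.eq_1 U)
  let u : LatticeSpace K → ℂ := U.indicator 1
  -- The element is `p a p + (1 - p) a (1 - p)`. On functions, the factor `1 - u(r) - u(s) + 2 u(r)
  -- u(s)` is `1` when range and source are both in `U` or both outside, and `0` otherwise.
  refine ⟨fun γ => f γ - u (range γ) * f γ - f γ * u (source γ) +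
    2 * (u (range γ) * f γ * u (source γ)), a - p * a - a * p + (2 : ℂ) • (p * a * p),
    isLeftConvolution_of_entry (fun L N M h1 h2 h3 => ?_) fun γ γ' h => ?_, ?_, fun γ hγ => ?_⟩
  · change entry (a.1 - rangeProj U * a.1 - a.1 * rangeProj U +
      (2 : ℂ) • (rangeProj U * a.1 * rangeProj U)) _ _ = _
    simp only [entry_add, entry_sub, entry_smul, rangeProj, mulRange_mul_entry,
      mul_mulRange_entry, ha.entry_eq h1 h2 h3, range_mk, source_mk, u]
  · change entry (a.1 - rangeProj U * a.1 - a.1 * rangeProj U +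
      (2 : ℂ) • (rangeProj U * a.1 * rangeProj U)) _ _ = _
    simp only [entry_add, entry_sub, entry_smul, rangeProj, mulRange_mul_entry,
      mul_mulRange_entry, ha.entry_eq_zero h]
    simp
  -- By the trace property and `p² = p`, the values at `p a`, `a p` and `p a p` coincide, so the
  -- corrections cancel.
  · have h1 : φ (p * a * p) = φ (a * p) := by rw [mul_assoc, hcomm, mul_assoc, hpp]
    rw [map_add, map_sub, map_sub, map_smul, hcomm, h1, smul_eq_mul]
    ring
  · by_cases hr : range γ ∈ U <;> by_cases hs : source γ ∈ U <;>
      simp only [u, hr, hs, Set.indicator_of_mem, Set.indicator_of_notMem, not_false_eq_true,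
        Pi.one_apply] at hγ ⊢ <;> ring_nf at hγ <;> simp_all

theorem IsKMSState.exists_restrict_list (hβ : 0 < β) (hφ : IsKMSState timeEvolution β φ)
    (l : List (Set (LatticeSpace K))) (hl : ∀ U ∈ l, IsClopen U) {f : CommGroupoid K → ℂ}
    {a : CMAlgebra K} (ha : IsLeftConvolution f a.1) :
    ∃ (f' : CommGroupoid K → ℂ) (a' : CMAlgebra K), IsLeftConvolution f' a'.1 ∧ φ a' = φ a ∧
      ∀ γ, f' γ ≠ 0 → f γ ≠ 0 ∧ ∀ U ∈ l, (range γ ∈ U ↔ source γ ∈ U) := by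
  induction l with
  | nil => exact ⟨f, a, ha, rfl, fun γ h => ⟨h, by simp⟩⟩
  | cons V l ih =>
    obtain ⟨f₁, a₁, h₁, hφ₁, hf₁⟩ := ih fun U hU => hl U (List.mem_cons_of_mem _ hU)
    obtain ⟨f₂, a₂, h₂, hφ₂, hf₂⟩ := hφ.exists_restrict hβ (hl V List.mem_cons_self) h₁
    refine ⟨f₂, a₂, h₂, hφ₂.trans hφ₁, fun γ hγ => ?_⟩
    obtain ⟨hγ₁, hV⟩ := hf₂ γ hγ
    obtain ⟨hγ₀, hl'⟩ := hf₁ γ hγ₁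
    exact ⟨hγ₀, List.forall_mem_cons.2 ⟨hV, hl'⟩⟩

/-- By compactness, finitely many clopen `U` suffice for every arrow of `s` to have range inside and
source outside some `U`. Restricting successively to arrows respecting each `U` leaves the zero
function without changing `φ`. -/
theorem IsKMSState.apply_eq_zero_of_range_ne_source (hβ : 0 < β)
    (hφ : IsKMSState timeEvolution β φ) {f : CommGroupoid K → ℂ} {a : CMAlgebra K}
    (ha : IsLeftConvolution f a.1) {s : Set (CommGroupoid K)} (hs : IsCompact s)
    (hsup : ∀ γ, f γ ≠ 0 → γ ∈ s) (hne : ∀ γ ∈ s, range γ ≠ source γ) : φ a = 0 := by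
  obtain ⟨t, ht⟩ := hs.elim_finite_subcover
    (fun U : {U : Set (LatticeSpace K) // IsClopen U} => {γ | range γ ∈ U.1 ∧ source γ ∈ U.1ᶜ})
    (fun U => (U.2.2.preimage continuous_range).inter
      (U.2.1.isOpen_compl.preimage continuous_source)) fun γ hγ => by
        obtain ⟨U, hU, h1, h2⟩ := LatticeSpace.exists_isClopen (hne γ hγ)
        exact Set.mem_iUnion.2 ⟨⟨U, hU⟩, h1, h2⟩
  obtain ⟨f', a', ha', hφ', hf'⟩ := hφ.exists_restrict_list hβ (t.toList.map Subtype.val)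
    (fun U hU => by
      obtain ⟨V, -, rfl⟩ := List.mem_map.1 hU
      exact V.2) ha
  have h0 : f' = fun _ => 0 := by
    funext γ
    by_contra hγ
    obtain ⟨h1, h2⟩ := hf' γ hγ
    have := ht (hsup γ h1)
    simp only [Set.mem_iUnion] at this
    obtain ⟨U, hU, hr, hsrc⟩ := this
    exact hsrc ((h2 U.1 (List.mem_map.2 ⟨U, Finset.mem_toList.2 hU, rfl⟩)).1 hr)
  rw [h0] at ha'
  rw [← hφ', show a' = 0 from Subtype.ext (ha'.unique .zero), map_zero]

/-- A KMS state vanishes on the convolutions by functions that vanish on the units. -/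
theorem IsKMSState.apply_eq_zero (hβ : 0 < β) (hφ : IsKMSState timeEvolution β φ)
    {f : CommGroupoid K → ℂ} {a : CMAlgebra K} (ha : IsLeftConvolution f a.1)
    (hf : HasCompactSupport f) (h0 : ∀ x, f (unit x) = 0) : φ a = 0 := by
  classical
  let _ := CMAlgebra.cstarAlgebra K
  -- Index `n + 1` keeps the integer positive. The first factor is `φ(p)^(1/2)` for the projection
  -- `p` onto classes divisible by `n + 1`.
  have key : ∀ n : ℕ, ‖φ a‖ ≤ √(Real.exp (-(2 * β * Real.log (n + 1 : ℕ)))) *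
      √(φ (star a * a)).re := by
    intro n
    let p : CMAlgebra K := ⟨rangeProj (divisible K (n + 1)),
      convAlgebra_le (rangeProj_mem (isClopen_divisible (n + 1)))⟩
    have hstar : star p = p := Subtype.ext (star_rangeProj _)
    have hpp : p * p = p := Subtype.ext (rangeProj_mul_self _)
    have h1 : φ (a - p * a) = 0 := by
      have hconv : IsLeftConvolution (fun γ => f γ -
          (divisible K (n + 1)).indicator 1 (range γ) * f γ) (a - p * a).1 := by
        refine isLeftConvolution_of_entry (fun L N M h1 h2 h3 => ?_) fun γ γ' h => ?_
        · change entry (a.1 - rangeProj _ * a.1) _ _ = _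
          rw [entry_sub, rangeProj, mulRange_mul_entry, ha.entry_eq h1 h2, range_mk, range_mk]
        · change entry (a.1 - rangeProj _ * a.1) _ _ = _
          rw [entry_sub, rangeProj, mulRange_mul_entry, ha.entry_eq_zero h, mul_zero, sub_zero]
      -- Away from units and from divisible ranges there is no isotropy. Both removed sets are open,
      -- so what remains of the support of `f` is compact.
      refine hφ.apply_eq_zero_of_range_ne_source hβ hconv
        (s := tsupport f ∩ ((Set.range unit)ᶜ ∩ range ⁻¹' (divisible K (n + 1))ᶜ))
        (hf.isCompact.inter_right (isClopen_range_unit.2.isClosed_compl.inter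
          ((isClopen_divisible (n + 1)).2.isClosed_compl.preimage continuous_range)))
        (fun γ hγ => ?_) fun γ hγ => range_ne_source hγ.2.1 hγ.2.2
      refine ⟨subset_tsupport f fun h => hγ (by simp [h]), ?_, fun hr => ?_⟩
      · rintro ⟨x, rfl⟩
        exact hγ (by simp [h0])
      · exact hγ (by simp [hr])
    -- As `φ(a) = φ(p a)`, Cauchy–Schwarz for `p* a` gives the bound.
    have h2 := IsState.norm_apply_star_mul_le (A := CMAlgebra K) hφ.toIsState p a
    rw [map_sub, sub_eq_zero] at h1
    rw [hstar, hpp, ← h1, hφ.apply_divisible hβ (n + 1) rfl] at h2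
    exact h2
  have hlim : Filter.Tendsto (fun n : ℕ => √(Real.exp (-(2 * β * Real.log (n + 1 : ℕ)))) *
      √(φ (star a * a)).re) Filter.atTop (nhds (√0 * √(φ (star a * a)).re)) := by
    refine Filter.Tendsto.mul_const _ (Filter.Tendsto.sqrt ?_)
    refine Real.tendsto_exp_neg_atTop_nhds_zero.comp
      (Filter.Tendsto.const_mul_atTop (by positivity) ?_)
    exact Real.tendsto_log_atTop.comp
      (tendsto_natCast_atTop_atTop.comp (Filter.tendsto_add_atTop_nat 1))
  rw [Real.sqrt_zero, zero_mul] at hlim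
  exact norm_le_zero_iff.1 (ge_of_tendsto' hlim key)

end Vanishing

/-! ### The diagonal subalgebra and the measure -/

/-- The multiplication by a continuous function on `X`. -/
def diagOp (g : C(LatticeSpace K, ℂ)) : CMAlgebra K :=
  ⟨mulRange g ‖g‖ g.norm_coe_le_norm, convAlgebra_le (mulRange_mem_convAlgebra _ _ _)⟩

open Classical in
theorem entry_diagOp (g : C(LatticeSpace K, ℂ)) (γ γ' : CommGroupoid K) :
    entry (diagOp g).1 γ γ' = if γ = γ' then g (range γ) else 0 :=
  entry_weightedComp (fun γ => g (range γ)) id Function.injective_id ‖g‖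
    (fun _ => g.norm_coe_le_norm _) γ γ'

theorem diagOp_add (g h : C(LatticeSpace K, ℂ)) : diagOp (g + h) = diagOp g + diagOp h := by
  classical
  refine Subtype.ext (ext_entry fun γ γ' => ?_)
  change _ = entry ((diagOp g).1 + (diagOp h).1) γ γ'
  rw [entry_add, entry_diagOp, entry_diagOp, entry_diagOp]
  split_ifs <;> simp

theorem diagOp_smul (c : ℂ) (g : C(LatticeSpace K, ℂ)) : diagOp (c • g) = c • diagOp g := by
  classical
  refine Subtype.ext (ext_entry fun γ γ' => ?_)
  change _ = entry (c • (diagOp g).1) γ γ'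
  rw [entry_smul, entry_diagOp, entry_diagOp]
  split_ifs <;> simp

theorem diagOp_one : diagOp (1 : C(LatticeSpace K, ℂ)) = 1 := by
  classical
  refine Subtype.ext (ext_entry fun γ γ' => ?_)
  change _ = entry 1 γ γ'
  rw [entry_diagOp, entry_one]
  rfl

theorem diagOp_star_mul (g : C(LatticeSpace K, ℂ)) :
    star (diagOp g) * diagOp g = diagOp (star g * g) := by
  classical
  refine Subtype.ext (ext_entry fun γ γ' => ?_)
  refine (hasSum_entry_mul (star (diagOp g).1) (diagOp g).1 γ γ').unique ?_
  convert hasSum_single γ fun γ'' h => ?_ using 1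
  · rw [entry_star, entry_diagOp, entry_diagOp, entry_diagOp, if_pos rfl]
    split_ifs <;> simp
  · rw [entry_star, entry_diagOp, if_neg h, star_zero, zero_mul]

/-- A real function as a complex function. -/
def realToComplex (g : C(LatticeSpace K, ℝ)) : C(LatticeSpace K, ℂ) :=
  ⟨fun x => (g x : ℂ), by fun_prop⟩

section State

variable {φ : CMAlgebra K →ₗ[ℂ] ℂ}

open scoped ComplexOrder in
theorem IsState.diagOp_nonneg (hφ : IsState φ) {g : C(LatticeSpace K, ℝ)} (hg : ∀ x, 0 ≤ g x) :
    0 ≤ φ (diagOp (realToComplex g)) := by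
  have : realToComplex g = star (realToComplex ⟨fun x => √(g x), by fun_prop⟩) *
      realToComplex ⟨fun x => √(g x), by fun_prop⟩ := by
    ext x
    change (g x : ℂ) = star ((√(g x) : ℝ) : ℂ) * ((√(g x) : ℝ) : ℂ)
    rw [Complex.star_def, Complex.conj_ofReal, ← Complex.ofReal_mul, Real.mul_self_sqrt (hg x)]
  rw [this, ← diagOp_star_mul]
  exact hφ.nonneg _

/-- Adding the constant `‖g‖` makes `g` nonnegative, and positive elements have real values under
`φ`. -/
theorem IsState.diagOp_real (hφ : IsState φ) (g : C(LatticeSpace K, ℝ)) :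
    φ (diagOp (realToComplex g)) = ((φ (diagOp (realToComplex g))).re : ℂ) := by
  have h1 := (hφ.diagOp_nonneg (g := g + ContinuousMap.const _ ‖g‖) fun x => by
    have := (abs_le.1 (g.norm_coe_le_norm x)).1
    simpa using (by linarith : 0 ≤ g x + ‖g‖)).2
  have h2 : realToComplex (g + ContinuousMap.const _ ‖g‖) =
      realToComplex g + (‖g‖ : ℂ) • (1 : C(LatticeSpace K, ℂ)) := by
    ext x
    simp [realToComplex]
  rw [h2, diagOp_add, diagOp_smul, diagOp_one, map_add, map_smul, hφ.map_one] at h1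
  refine Complex.ext (by simp) ?_
  simpa using h1.symm

variable [Algebra.IsQuadraticExtension ℚ K] [IsTotallyComplex K]

open CompactlySupported in
/-- The restriction of a state to the real functions on `X`. -/
def IsState.functional (hφ : IsState φ) : C_c(LatticeSpace K, ℝ) →ₚ[ℝ] ℝ :=
  PositiveLinearMap.mk₀
    { toFun := fun g => (φ (diagOp (realToComplex g.toContinuousMap))).re
      map_add' := fun g h => by
        rw [show realToComplex (g + h).toContinuousMap =
          realToComplex g.toContinuousMap + realToComplex h.toContinuousMap by
            ext x; exact Complex.ofReal_add _ _, diagOp_add, map_add, Complex.add_re]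
      map_smul' := fun c g => by
        rw [show realToComplex (c • g).toContinuousMap =
          (c : ℂ) • realToComplex g.toContinuousMap by
            ext x; exact Complex.ofReal_mul _ _, diagOp_smul, map_smul, smul_eq_mul,
          Complex.re_ofReal_mul]
        rfl }
    fun _ hg => (hφ.diagOp_nonneg hg).1

/-- The probability measure on `X` given by a state of `A_K`. -/
def IsState.measure (hφ : IsState φ) : Measure (LatticeSpace K) :=
  RealRMK.rieszMeasure hφ.functional

theorem IsState.integral_real (hφ : IsState φ) (g : C(LatticeSpace K, ℝ)) :
    ∫ x, g x ∂hφ.measure = (φ (diagOp (realToComplex g))).re :=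
  RealRMK.integral_rieszMeasure hφ.functional
    ⟨g, HasCompactSupport.of_compactSpace g⟩

instance IsState.isProbabilityMeasure_measure (hφ : IsState φ) :
    IsProbabilityMeasure hφ.measure := by
  have h := hφ.integral_real 1
  have h1 : realToComplex (1 : C(LatticeSpace K, ℝ)) = 1 := by
    ext x
    exact Complex.ofReal_one
  rw [h1, diagOp_one, hφ.map_one] at h
  simp only [ContinuousMap.one_apply, integral_const, smul_eq_mul, mul_one, Complex.one_re] at h
  refine ⟨?_⟩
  rw [Measure.real] at h
  rwa [ENNReal.toReal_eq_one_iff] at h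

theorem IsState.integrable (hφ : IsState φ) {g : LatticeSpace K → ℂ} (hg : Continuous g) :
    Integrable g hφ.measure :=
  hg.integrable_of_hasCompactSupport (HasCompactSupport.of_compactSpace g)

theorem IsState.integral_diagOp (hφ : IsState φ) (g : C(LatticeSpace K, ℂ)) :
    φ (diagOp g) = ∫ x, g x ∂hφ.measure := by
  let gr : C(LatticeSpace K, ℝ) := ⟨fun x => (g x).re, by fun_prop⟩
  let gi : C(LatticeSpace K, ℝ) := ⟨fun x => (g x).im, by fun_prop⟩
  have hg : g = realToComplex gr + Complex.I • realToComplex gi := by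
    ext x
    change g x = ((g x).re : ℂ) + Complex.I * ((g x).im : ℂ)
    rw [mul_comm, Complex.re_add_im]
  have hint := integral_re_add_im (hφ.integrable g.continuous)
  have h1 : ∫ x, (g x).re ∂hφ.measure = (φ (diagOp (realToComplex gr))).re := hφ.integral_real gr
  have h2 : ∫ x, (g x).im ∂hφ.measure = (φ (diagOp (realToComplex gi))).re := hφ.integral_real gi
  rw [← hint]
  change _ = ((∫ x, (g x).re ∂hφ.measure : ℝ) : ℂ) +
    ((∫ x, (g x).im ∂hφ.measure : ℝ) : ℂ) * Complex.I
  rw [h1, h2, ← hφ.diagOp_real, ← hφ.diagOp_real, hg, diagOp_add, diagOp_smul, map_add, map_smul,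
    smul_eq_mul, mul_comm Complex.I]

end State

/-! ### Identification of the state with the integral, and passage to the completion -/

section

variable [Algebra.IsQuadraticExtension ℚ K] [IsTotallyComplex K]
variable {β : ℝ} {φ : CMAlgebra K →ₗ[ℂ] ℂ}

theorem continuous_diag_of_mem_convAlgebra {a : CMAlgebra K} (ha : a.1 ∈ convAlgebra K) :
    Continuous (CMAlgebra.diag a) := by
  obtain ⟨f, hf, -, h⟩ := ha
  exact (hf.comp continuous_unit).congr fun x => (h.entry_unit x).symm

theorem IsKMSState.apply_of_mem_convAlgebra (hβ : 0 < β) (hφ : IsKMSState timeEvolution β φ)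
    {a : CMAlgebra K} (ha : a.1 ∈ convAlgebra K) :
    φ a = ∫ x, CMAlgebra.diag a x ∂hφ.toIsState.measure := by
  classical
  obtain ⟨f, hf, hc, h⟩ := ha
  let g : C(LatticeSpace K, ℂ) := ⟨f ∘ unit, hf.comp continuous_unit⟩
  have hdiag : ∀ x, CMAlgebra.diag a x = g x := fun x => h.entry_unit x
  have hg := isLeftConvolution_mulRange g ‖g‖ g.norm_coe_le_norm
  -- Subtracting from `f` its restriction to the units leaves a function vanishing on units, so `φ`
  -- sees only the diagonal part.
  have hsub : IsLeftConvolution (f + fun γ => -1 *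
      if γ ∈ Set.range (unit : LatticeSpace K → CommGroupoid K) then g (range γ) else 0)
      (a + (-1 : ℂ) • diagOp g).1 := h.add (hg.smul (-1))
  have h0 := hφ.apply_eq_zero hβ hsub
    (hc.add (hasCompactSupport_unit_indicator g).mul_left) fun x => by
      have hx : range (unit x) = x := by
        induction x using LatticeSpace.ind with
        | h L => rfl
      rw [Pi.add_apply, if_pos ⟨x, rfl⟩, hx]
      change f (unit x) + -1 * f (unit x) = 0
      ring
  rw [map_add, map_smul, neg_one_smul, ← sub_eq_add_neg, sub_eq_zero] at h0
  rw [h0, hφ.toIsState.integral_diagOp]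
  simp only [hdiag]

theorem exists_mem_convAlgebra_norm_sub_lt (a : CMAlgebra K) {ε : ℝ} (hε : 0 < ε) :
    ∃ b : CMAlgebra K, b.1 ∈ convAlgebra K ∧ ‖a - b‖ < ε := by
  have ha : a.1 ∈ closure (convAlgebra K : Set (HilbertSpace K →L[ℂ] HilbertSpace K)) :=
    (CMAlgebra_eq (K := K)).le a.2
  obtain ⟨b, hb, hab⟩ := Metric.mem_closure_iff.1 ha ε hε
  exact ⟨⟨b, convAlgebra_le hb⟩, hb, by rwa [dist_eq_norm] at hab⟩

theorem norm_diag_sub_le (a b : CMAlgebra K) (x : LatticeSpace K) :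
    ‖CMAlgebra.diag a x - CMAlgebra.diag b x‖ ≤ ‖a - b‖ :=
  norm_entry_le (a.1 - b.1) _ _

/-- Matrix coefficients are bounded by the operator norm, so norm approximation in the algebra is
uniform approximation of diagonals. -/
theorem continuous_diag (a : CMAlgebra K) : Continuous (CMAlgebra.diag a) := by
  refine continuous_of_uniform_approx_of_continuous fun u hu => ?_
  obtain ⟨ε, hε, hεu⟩ := Metric.mem_uniformity_dist.1 hu
  obtain ⟨b, hb, hab⟩ := exists_mem_convAlgebra_norm_sub_lt a hε
  refine ⟨_, continuous_diag_of_mem_convAlgebra hb, fun x => hεu ?_⟩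
  rw [dist_eq_norm]
  exact (norm_diag_sub_le a b x).trans_lt hab

/-- Both sides are continuous in `a`: the state is automatically bounded, and the integral is
contractive because the measure has mass one. They agree on the dense convolution algebra. -/
theorem IsKMSState.apply_eq_integral (hβ : 0 < β) (hφ : IsKMSState timeEvolution β φ)
    (a : CMAlgebra K) : φ a = ∫ x, CMAlgebra.diag a x ∂hφ.toIsState.measure := by
  obtain ⟨C, hC⟩ : ∃ C : ℝ, ∀ a, ‖φ a‖ ≤ C * ‖a‖ :=
    let _ := CMAlgebra.cstarAlgebra K
    IsState.exists_norm_le (A := CMAlgebra K) hφ.toIsState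
  have key : ∀ ε > 0, ‖φ a - ∫ x, CMAlgebra.diag a x ∂hφ.toIsState.measure‖ ≤ (|C| + 1) * ε := by
    intro ε hε
    obtain ⟨b, hb, hab⟩ := exists_mem_convAlgebra_norm_sub_lt a hε
    have h1 : ‖φ a - φ b‖ ≤ |C| * ε := by
      rw [← map_sub]
      refine (hC _).trans ?_
      gcongr
      exact le_abs_self C
    have h2 : ‖∫ x, (CMAlgebra.diag b x - CMAlgebra.diag a x) ∂hφ.toIsState.measure‖ ≤ ε := by
      refine (norm_integral_le_of_norm_le_const (C := ε) (.of_forall fun x => ?_)).trans ?_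
      · rw [norm_sub_rev]
        exact (norm_diag_sub_le a b x).trans hab.le
      · simp
    rw [integral_sub (hφ.toIsState.integrable (continuous_diag b))
      (hφ.toIsState.integrable (continuous_diag a)), ← hφ.apply_of_mem_convAlgebra hβ hb] at h2
    calc _ = ‖(φ a - φ b) + (φ b - ∫ x, CMAlgebra.diag a x ∂hφ.toIsState.measure)‖ := by
          rw [sub_add_sub_cancel]
      _ ≤ |C| * ε + ε := (norm_add_le _ _).trans (add_le_add h1 h2)
      _ = (|C| + 1) * ε := by ring
  have hC0 : 0 < |C| + 1 := by positivity
  refine sub_eq_zero.1 (norm_le_zero_iff.1 (le_of_forall_pos_le_add fun ε hε => ?_))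
  have := key (ε / (|C| + 1)) (by positivity)
  rwa [mul_div_cancel₀ _ hC0.ne', ← zero_add ε] at this

end

end CMSystem

end

theorem proposition4 (K : Type*) [Field K] [NumberField K] [Algebra.IsQuadraticExtension ℚ K]
    [NumberField.IsTotallyComplex K] [Algebra K ℂ] (β : ℝ) (hβ : 0 < β)
    (φ : CMSystem.CMAlgebra K →ₗ[ℂ] ℂ) (hφ : CMSystem.IsKMSState CMSystem.timeEvolution β φ) :
    ∃ μ : MeasureTheory.Measure (CMSystem.LatticeSpace K),
      MeasureTheory.IsProbabilityMeasure μ ∧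
      ∀ f : CMSystem.CMAlgebra K, 
        MeasureTheory.Integrable (CMSystem.CMAlgebra.diag f) μ ∧
          φ f = ∫ L, CMSystem.CMAlgebra.diag f L ∂μ :=
  ⟨hφ.toIsState.measure, hφ.toIsState.isProbabilityMeasure_measure, fun f =>
    ⟨hφ.toIsState.integrable (CMSystem.continuous_diag f), hφ.apply_eq_integral hβ f⟩⟩
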